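/- Strings are finite sequences of characters, and characters are natural numbers. For a pattern $P$ and a text $T$, an occurrence of $P$ in $T$ is a position $0\le i<|T|$ such that $P$ is a prefix of the suffix $T_i$ of $T$ starting at $i$. Let $\mathcal{SA}$ be the suffix array of $T$ (the positions $0,\dots,|T|-1$, sorted by the lexicographic order of the suffixes starting there), $\mathcal{ISA}$ its inverse, and $\mathcal{LCP}$ the array of the lengths of the longest common prefixes of lexicographically consecutive suffixes. The suffix range of $P$ is the set of all $j$ such that $\mathcal{SA}[j]$ is an occurrence of $P$; it is given by its end points, as $[\ell,r)$, and as $[0,0)$ if $P$ does not occur in $T$. An occurrence partition of $P$ with respect to $T$ is a finite sequence $(P_1,\dots,P_k)$ of nonempty strings with $P=P_1\circ\dots\circ P_k$ such that (occurrence) each $P_i$ is a substring of $T$ or a single character that does not occur in $T$, and (maximality) $P_i\circ P_{i+1}$ is not a substring of $T$ for $1\le i<k$. Such a partition is stored in a height-balanced (AVL) binary search tree whose in-order sequence of parts is $(P_1,\dots,P_k)$. Each node holds its height, the total length of the parts in its subtree, pointers to its two children, and, for its part $p$, the length $|p|$, the end points of the suffix range of $p$, and the first character of $p$. Algorithms are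 fixed programs (independent of $T$ and $P$) made of mutually recursive first-order functions on numbers and pointer structures, with random access to the read-only arrays $T$, $\mathcal{SA}$, $\mathcal{ISA}$, $\mathcal{LCP}$ and to a segment tree, of size $O(|T|)$, for range minima of $\mathcal{LCP}$. Each elementary operation (addition, truncated subtraction, halving or comparison of numbers, reading an array cell or an array length, creating a pair or following a pointer, reading a variable or a constant, testing whether a value is a number, binding a variable, calling a function) costs one unit of time; there is no multiplication. Theorem. There are a program and a constant $C$ such that the following holds for all strings $T$ and $P$ with $|P|\le|T|$ and for every tree storing, as above, any occurrence partition of $P$ with respect to $T$. 1. (Insertion) Given this tree, a position $0\le i\le|P|$ and a character $c$, the program computes, in at most $C(\lfloor\log_2|T|\rfloor+1)$ steps, a tree storing an occurrence partition with respect to $T$ of the string obtained from $P$ by inserting $c$ before position $i$ (at the end if $i=|P|$). 2. (Deletion) Given this tree and a position $0\le i<|P|$, the program computes, in at most $C(\lfloor\log_2|T|\rfloor+1)$ steps, a tree storing an occurrence partition with respect to $T$ of the string obtained from $P$ by deleting the character at position $i$. 3. (Counting) Given this tree, the program computes the number of occurrences of $P$ in $T$ in at most $C$ steps. Here $\lfloor\log_2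 0\rfloor$ is read as $0$. In particular, insertion and deletion take $O(\log|T|)$ time. -/

import Mathlib

namespace DynPattern

/-! ### Strings, occurrences, suffix arrays

Strings are lists of characters, and characters are natural numbers. -/

/-- The positions `0 ≤ i < |T|` at which `P` occurs in `T`. -/
def occurrences (P T : List ℕ) : Finset ℕ :=
  (Finset.range T.length).filter fun i => P <+: T.drop i

/-- The suffix array of `T`: the starting positions of the nonempty suffixes of `T`, in the
lexicographic order of these suffixes. -/
def suffixArray (T : List ℕ) : List ℕ :=
  (List.range T.length).mergeSort fun i j => decide (T.drop i ≤ T.drop j)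

/-- The inverse suffix array: entry `j` is the rank of the suffix that starts at `j`. -/
def inverseSuffixArray (T : List ℕ) : List ℕ :=
  (List.range T.length).map fun j => (suffixArray T).idxOf j

/-- The length of the longest common prefix of two strings. -/
def lcpLength : List ℕ → List ℕ → ℕ
  | a :: s, b :: t => if a = b then lcpLength s t + 1 else 0
  | _, _ => 0

/-- The lcp array: entry `i < |T| - 1` is the length of the longest common prefix of the
suffixes of rank `i` and `i + 1`. -/
def lcpArray (T : List ℕ) : List ℕ :=
  (List.range (T.length - 1)).map fun i =>
    lcpLength (T.drop ((suffixArray T).getD i 0)) (T.drop ((suffixArray T).getD (i + 1) 0))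

/-- The linear-size range minimum structure (segment tree) of an array `A`, in heap order.
Let `m` be the least power of two with `|A| ≤ m`. The complete binary tree with `m` leaves has
its root at `1`, the children of `k` at `2 k` and `2 k + 1`, and its leaves at `m, …, 2 m - 1`.
Node `k`, at depth `d = ⌊log₂ k⌋`, holds the minimum of the block of `A` below it, which has
length `m / 2 ^ d` and starts at `(k - 2 ^ d) * (m / 2 ^ d)` (cut off at the end of `A`; an empty
block has the value `0`). Entry `0` is not used by the tree. -/
def minTree (A : List ℕ) : List ℕ :=
  let m := 2 ^ Nat.clog 2 A.length
  (List.range (2 * m)).map fun k =>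
    let d := Nat.log 2 k
    ((A.drop ((k - 2 ^ d) * (m / 2 ^ d))).take (m / 2 ^ d)).min?.getD 0

/-- The suffix range of `P` with respect to `T`, as a set of ranks. -/
def suffixRange (P T : List ℕ) : Finset ℕ :=
  (Finset.range T.length).filter fun i => (suffixArray T).getD i 0 ∈ occurrences P T

/-- `[l, r)` is the representation of the suffix range of `P` by its end points, with the
convention `[0, 0)` if `P` does not occur in `T`. -/
def IsSuffixRange (P T : List ℕ) (l r : ℕ) : Prop :=
  suffixRange P T = Finset.Ico l r ∧ (¬ P <:+: T → l = 0 ∧ r = 0)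

/-- `parts` is an occurrence partition of the pattern `P` with respect to the text `T`. -/
structure IsOccurrencePartition (P T : List ℕ) (parts : List (List ℕ)) : Prop where
  flatten_eq : parts.flatten = P
  ne_nil : ∀ p ∈ parts, p ≠ []
  occurrence : ∀ p ∈ parts, p <:+: T ∨ ∃ c, p = [c] ∧ c ∉ T
  maximality : parts.IsChain fun p q => ¬ (p ++ q) <:+: T

/-! ### The machine

A program is a fixed finite list of first-order, mutually recursive functions, working on pointer
structures (numbers and immutable pairs) and on read-only arrays with random access. Every
elementary operation costs one unit of time: building a pair, following a pointer, adding,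
subtracting, halving or comparing two numbers, reading an array cell, looking up a variable,
calling a function. There is no multiplication and no shift to the left, so one step makes the
largest number at most one bit longer (up to constants of the program). -/

/-- A value that fits in one cell: a number, or a pointer to a pair. -/
inductive Val
  | num (n : ℕ)
  | pair (a b : Val)

/-- The names of the read-only arrays. -/
inductive ArrayName
  | text
  | sa
  | isa
  | lcp
  | lcpMin

/-- Expressions; variables are de Bruijn indices. -/
inductive Expr
  /-- a variable -/
  | var (i : ℕ)
  /-- a constant -/
  | lit (n : ℕ)
  /-- a new pair -/
  | pair (e₁ e₂ : Expr)
  /-- first component of a pair -/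
  | fst (e : Expr)
  /-- second component of a pair -/
  | snd (e : Expr)
  /-- sum of two numbers -/
  | add (e₁ e₂ : Expr)
  /-- truncated difference of two numbers -/
  | sub (e₁ e₂ : Expr)
  /-- half of a number, rounded down -/
  | half (e : Expr)
  /-- length of an array -/
  | len (A : ArrayName)
  /-- the array cell at a computed position -/
  | read (A : ArrayName) (e : Expr)
  /-- if the number `e₁` is less than the number `e₂` then `e₃` else `e₄` -/
  | ifLt (e₁ e₂ e₃ e₄ : Expr)
  /-- if `e₁` is a number (not a pair) then `e₂` else `e₃` -/
  | ifNum (e₁ e₂ e₃ : Expr)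
  /-- compute `e₁` and bind it to variable `0` in `e₂` -/
  | letIn (e₁ e₂ : Expr)
  /-- call function number `f` of the program with one argument -/
  | call (f : ℕ) (e : Expr)

/-- A program: the bodies of its functions. The argument of a function is variable `0` of its
body, and the body has no other free variable. -/
abbrev Program := List Expr

/-- `Eval prog arr env e v t`: with variables `env` and arrays `arr`, the expression `e` evaluates
to `v` in exactly `t` steps. There is no evaluation where an operation is undefined (an unbound
variable, a component of a number, arithmetic on a pair, an array access out of bounds, an
unknown function) or where the computation does not end. -/
inductive Eval (prog : Program) (arr : ArrayName → List ℕ) :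
    List Val → Expr → Val → ℕ → Prop
  | var {env : List Val} {i : ℕ} {v : Val} (h : env[i]? = some v) :
      Eval prog arr env (.var i) v 1
  | lit {env : List Val} (n : ℕ) :
      Eval prog arr env (.lit n) (.num n) 1
  | pair {env : List Val} {e₁ e₂ : Expr} {v₁ v₂ : Val} {t₁ t₂ : ℕ}
      (h₁ : Eval prog arr env e₁ v₁ t₁) (h₂ : Eval prog arr env e₂ v₂ t₂) :
      Eval prog arr env (.pair e₁ e₂) (.pair v₁ v₂) (t₁ + t₂ + 1)
  | fst {env : List Val} {e : Expr} {v₁ v₂ : Val} {t : ℕ}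
      (h : Eval prog arr env e (.pair v₁ v₂) t) :
      Eval prog arr env (.fst e) v₁ (t + 1)
  | snd {env : List Val} {e : Expr} {v₁ v₂ : Val} {t : ℕ}
      (h : Eval prog arr env e (.pair v₁ v₂) t) :
      Eval prog arr env (.snd e) v₂ (t + 1)
  | add {env : List Val} {e₁ e₂ : Expr} {m n t₁ t₂ : ℕ}
      (h₁ : Eval prog arr env e₁ (.num m) t₁) (h₂ : Eval prog arr env e₂ (.num n) t₂) :
      Eval prog arr env (.add e₁ e₂) (.num (m + n)) (t₁ + t₂ + 1)
  | sub {env : List Val} {e₁ e₂ : Expr} {m n t₁ t₂ : ℕ}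
      (h₁ : Eval prog arr env e₁ (.num m) t₁) (h₂ : Eval prog arr env e₂ (.num n) t₂) :
      Eval prog arr env (.sub e₁ e₂) (.num (m - n)) (t₁ + t₂ + 1)
  | half {env : List Val} {e : Expr} {n t : ℕ}
      (h : Eval prog arr env e (.num n) t) :
      Eval prog arr env (.half e) (.num (n / 2)) (t + 1)
  | len {env : List Val} (A : ArrayName) :
      Eval prog arr env (.len A) (.num (arr A).length) 1
  | read {env : List Val} {A : ArrayName} {e : Expr} {i x t : ℕ}
      (h : Eval prog arr env e (.num i) t) (hx : (arr A)[i]? = some x) :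
      Eval prog arr env (.read A e) (.num x) (t + 1)
  | ifLt_true {env : List Val} {e₁ e₂ e₃ e₄ : Expr} {m n t₁ t₂ t₃ : ℕ} {v : Val}
      (h₁ : Eval prog arr env e₁ (.num m) t₁) (h₂ : Eval prog arr env e₂ (.num n) t₂)
      (h : m < n) (h₃ : Eval prog arr env e₃ v t₃) :
      Eval prog arr env (.ifLt e₁ e₂ e₃ e₄) v (t₁ + t₂ + t₃ + 1)
  | ifLt_false {env : List Val} {e₁ e₂ e₃ e₄ : Expr} {m n t₁ t₂ t₄ : ℕ} {v : Val}
      (h₁ : Eval prog arr env e₁ (.num m) t₁) (h₂ : Eval prog arr env e₂ (.num n) t₂)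
      (h : ¬ m < n) (h₄ : Eval prog arr env e₄ v t₄) :
      Eval prog arr env (.ifLt e₁ e₂ e₃ e₄) v (t₁ + t₂ + t₄ + 1)
  | ifNum_num {env : List Val} {e₁ e₂ e₃ : Expr} {n t₁ t₂ : ℕ} {v : Val}
      (h₁ : Eval prog arr env e₁ (.num n) t₁) (h₂ : Eval prog arr env e₂ v t₂) :
      Eval prog arr env (.ifNum e₁ e₂ e₃) v (t₁ + t₂ + 1)
  | ifNum_pair {env : List Val} {e₁ e₂ e₃ : Expr} {a b : Val} {t₁ t₃ : ℕ} {v : Val}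
      (h₁ : Eval prog arr env e₁ (.pair a b) t₁) (h₃ : Eval prog arr env e₃ v t₃) :
      Eval prog arr env (.ifNum e₁ e₂ e₃) v (t₁ + t₃ + 1)
  | letIn {env : List Val} {e₁ e₂ : Expr} {v₁ v₂ : Val} {t₁ t₂ : ℕ}
      (h₁ : Eval prog arr env e₁ v₁ t₁) (h₂ : Eval prog arr (v₁ :: env) e₂ v₂ t₂) :
      Eval prog arr env (.letIn e₁ e₂) v₂ (t₁ + t₂ + 1)
  | call {env : List Val} {f : ℕ} {e body : Expr} {a v : Val} {t₁ t₂ : ℕ}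
      (h₁ : Eval prog arr env e a t₁) (hf : prog[f]? = some body)
      (h₂ : Eval prog arr [a] body v t₂) :
      Eval prog arr env (.call f e) v (t₁ + t₂ + 1)

/-- `Runs prog arr f a v t`: function number `f` of the program, called with the argument `a`,
returns `v` after exactly `t` steps. -/
def Runs (prog : Program) (arr : ArrayName → List ℕ) (f : ℕ) (a v : Val) (t : ℕ) : Prop :=
  ∃ body, prog[f]? = some body ∧ Eval prog arr [a] body v t

/-- The arrays that the machine can read: the text, its suffix array, inverse suffix array and
lcp array, and the range minimum structure of the lcp array. -/
def textArrays (T : List ℕ) : ArrayName → List ℕ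
  | .text => T
  | .sa => suffixArray T
  | .isa => inverseSuffixArray T
  | .lcp => lcpArray T
  | .lcpMin => minTree (lcpArray T)

/-! ### The balanced search tree of the parts -/

/-- The parts stored in a tree, from left to right. -/
def inorder : BinaryTree (List ℕ) → List (List ℕ)
  | .nil => []
  | .node p l r => inorder l ++ p :: inorder r

/-- Height-balanced (AVL) trees: at every node, the heights of the two subtrees differ by at
most one. -/
def IsBalanced : BinaryTree (List ℕ) → Prop
  | .nil => True
  | .node _ l r =>
      l.height ≤ r.height + 1 ∧ r.height ≤ l.height + 1 ∧ IsBalanced l ∧ IsBalanced r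

/-- The record of a part `p`: its length, the end points of its suffix range, and its first
character. (The characters of a part that occurs in the text are read from the text.) -/
def EncodesPart (T p : List ℕ) (v : Val) : Prop :=
  ∃ l r, IsSuffixRange p T l r ∧
    v = .pair (.num p.length) (.pair (.num l) (.pair (.num r) (.num (p.headD 0))))

/-- The pointer structure of a tree of parts. The empty tree is the number `0`. A node holds its
height, the number of pattern characters below it (the search key is the position in the
pattern), the record of its part, and its two subtrees. -/
def EncodesTree (T : List ℕ) : BinaryTree (List ℕ) → Val → Prop
  | .nil, v => v = .num 0
  | .node p l r, v => ∃ vp vl vr, EncodesPart T p vp ∧ EncodesTree T l vl ∧ EncodesTree T r vr ∧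
      v = .pair (.num (BinaryTree.node p l r).height)
        (.pair (.num (inorder (.node p l r)).flatten.length) (.pair vp (.pair vl vr)))

/-- `v` stores an occurrence partition of `P` with respect to `T`, in a balanced search tree with
the suffix range of every part. -/
def StoresPartition (P T : List ℕ) (v : Val) : Prop :=
  ∃ t, IsBalanced t ∧ IsOccurrencePartition P T (inorder t) ∧ EncodesTree T t v

end DynPattern

namespace DynPattern

/-! ### Ranks of suffixes -/

/-! An edit touches a bounded number of parts. The part around the edited position is taken out and
cut in two (with the new character between the pieces, or without the deleted one). Starting from
the part before the gap as the pending part, the nonempty pieces and then the part after the gap are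
offered one by one. Each is merged with the pending part if the concatenation occurs in `T`;
otherwise the pending part goes back into the tree and the new piece becomes pending. No other pair
needs a test: if `x ++ z` does not occur in `T`, then neither does `y ++ z` for any `y` ending in
`x`, and symmetrically on the left (`Unmergeable.extend_head`, `Unmergeable.extend_last`). So
maximality survives the growth of the two outer neighbours.

Two computations on suffix ranges are needed. For a concatenation `p ++ q`, the suffixes starting
with `p` are ordered by what follows `p`. The rank of this remainder is therefore monotone on the
range of `p`, and binary search finds where it lies in the range of `q` (`append_prefix_iff`,
`computes_concat`). For a piece of a part that occurs in `T`, an occurrence is known from the range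
of the part. The range of the piece extends around the rank of that occurrence up to the nearest
smaller lcp entries on both sides (`isSuffixRange_of_lcp`), which a walk in the segment tree finds
(`computes_next`, `computes_prev`).

Parts are nonempty, so an AVL tree of parts has height logarithmic in the pattern length, hence in
`|T|` (`height_le`), and each tree operation follows a path. Counting is immediate: two or more
parts mean that the pattern does not occur, a single part carries its own range, and the empty
pattern occurs at every position.

Running times are derived through a weakest precondition that carries the step count (`wp`), and
recursive functions are treated by induction outside it. -/

theorem suffixArray_perm (T : List ℕ) : (suffixArray T).Perm (List.range T.length) :=
  List.mergeSort_perm _ _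

@[simp] theorem length_suffixArray (T : List ℕ) : (suffixArray T).length = T.length := by
  simpa using (suffixArray_perm T).length_eq

theorem suffixArray_nodup (T : List ℕ) : (suffixArray T).Nodup :=
  (suffixArray_perm T).nodup_iff.2 List.nodup_range

theorem suffixArray_pairwise (T : List ℕ) :
    (suffixArray T).Pairwise (fun i j => T.drop i ≤ T.drop j) := by
  have := List.pairwise_mergeSort (le := fun i j => decide (T.drop i ≤ T.drop j))
    (by intro a b c; simpa using le_trans) (by intro a b; simpa using le_total _ _)
    (List.range T.length)
  simpa [suffixArray] using this

/-- The starting position of the suffix of rank `i`. -/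
def sa (T : List ℕ) (i : ℕ) : ℕ := (suffixArray T).getD i 0

/-- The rank of the suffix that starts at position `j`. -/
def isa (T : List ℕ) (j : ℕ) : ℕ := (suffixArray T).idxOf j

/-- Entry `i` of the lcp array, continued by zeros. -/
def lcp (T : List ℕ) (i : ℕ) : ℕ := (lcpArray T).getD i 0

variable {T : List ℕ}

theorem suffixArray_getElem? {i : ℕ} (h : i < T.length) : (suffixArray T)[i]? = some (sa T i) := by
  simp [sa, h]

theorem sa_lt {i : ℕ} (h : i < T.length) : sa T i < T.length := by
  have : sa T i ∈ suffixArray T := List.mem_of_getElem? (suffixArray_getElem? h)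
  simpa using (suffixArray_perm T).mem_iff.1 this

theorem isa_lt {j : ℕ} (h : j < T.length) : isa T j < T.length := by
  have : j ∈ suffixArray T := (suffixArray_perm T).mem_iff.2 (by simpa using h)
  simpa [isa] using List.idxOf_lt_length_of_mem this

theorem sa_isa {j : ℕ} (h : j < T.length) : sa T (isa T j) = j := by
  have h' : isa T j < (suffixArray T).length := by simpa using isa_lt h
  have := List.idxOf_get (a := j) (l := suffixArray T) h'
  simp only [sa, List.getD_eq_getElem?_getD, List.getElem?_eq_getElem h', Option.getD_some]
  exact this

theorem inverseSuffixArray_getElem? {j : ℕ} (h : j < T.length) :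
    (inverseSuffixArray T)[j]? = some (isa T j) := by
  simp [inverseSuffixArray, isa, h]

theorem drop_sa_lt {i j : ℕ} (hij : i < j) (hj : j < T.length) :
    T.drop (sa T i) < T.drop (sa T j) := by
  have hi := hij.trans hj
  have h1 : i < (suffixArray T).length := by simpa using hi
  have h2 : j < (suffixArray T).length := by simpa using hj
  have e1 : sa T i = (suffixArray T)[i] := by
    simp only [sa, List.getD_eq_getElem?_getD, List.getElem?_eq_getElem h1, Option.getD_some]
  have e2 : sa T j = (suffixArray T)[j] := by
    simp only [sa, List.getD_eq_getElem?_getD, List.getElem?_eq_getElem h2, Option.getD_some]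
  refine lt_of_le_of_ne ?_ ?_
  · rw [e1, e2]
    exact List.pairwise_iff_getElem.1 (suffixArray_pairwise T) i j h1 h2 hij
  -- Suffixes at distinct positions have distinct lengths, so equality of the suffixes would repeat
  -- an entry of the suffix array.
  · intro h
    have hl := congrArg List.length h
    have := sa_lt hi
    have := sa_lt hj
    simp only [List.length_drop] at hl
    have h3 : sa T i = sa T j := by omega
    rw [e1, e2] at h3
    exact hij.ne ((suffixArray_nodup T).getElem_inj_iff.1 h3)

theorem drop_sa_le {i j : ℕ} (hij : i ≤ j) (hj : j < T.length) :
    T.drop (sa T i) ≤ T.drop (sa T j) := by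
  rcases hij.eq_or_lt with rfl | h
  · exact le_rfl
  · exact (drop_sa_lt h hj).le

theorem isa_lt_isa {a b : ℕ} (ha : a < T.length) (hb : b < T.length)
    (h : T.drop a < T.drop b) : isa T a < isa T b := by
  by_contra! hle
  have := drop_sa_le hle (isa_lt ha)
  rw [sa_isa ha, sa_isa hb] at this
  exact absurd h (not_lt.2 this)

/-! ### Prefixes and the lexicographic order -/

theorem cons_lt_cons_iff_lex {a b : ℕ} {s t : List ℕ} :
    a :: s < b :: t ↔ a < b ∨ a = b ∧ s < t := List.cons_lt_cons_iff

theorem cons_le_cons_iff_lex {a b : ℕ} {s t : List ℕ} :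
    a :: s ≤ b :: t ↔ a < b ∨ a = b ∧ s ≤ t := by
  rw [← not_lt, cons_lt_cons_iff_lex, ← not_lt (a := t)]
  by_cases h : t < s <;> simp [h] <;> omega

/-- The first letters are squeezed between equal letters, then induction. This convexity is why the
ranks of the suffixes with a given prefix form an interval. -/
theorem prefix_of_le_of_le {p a b c : List ℕ} (ha : p <+: a) (hc : p <+: c) (hab : a ≤ b)
    (hbc : b ≤ c) : p <+: b := by
  induction p generalizing a b c with
  | nil => exact List.nil_prefix
  | cons x p ih =>
    obtain ⟨s, rfl⟩ := ha
    obtain ⟨t, rfl⟩ := hc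
    cases b with
    | nil => exact absurd hab (not_le.2 (List.nil_lt_cons _ _))
    | cons y b =>
      simp only [List.cons_append, cons_le_cons_iff_lex] at hab hbc
      obtain ⟨rfl, h1, h2⟩ : x = y ∧ p ++ s ≤ b ∧ b ≤ p ++ t := by
        rcases hab with h | ⟨rfl, h1⟩
        · rcases hbc with h' | ⟨rfl, h2⟩ <;> omega
        · rcases hbc with h' | ⟨-, h2⟩
          · omega
          · exact ⟨rfl, h1, h2⟩
      exact (List.cons_prefix_cons.2
        ⟨rfl, ih (List.prefix_append _ _) (List.prefix_append _ _) h1 h2⟩)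

theorem append_lt_append_left_iff {p a b : List ℕ} : p ++ a < p ++ b ↔ a < b := by
  induction p with
  | nil => rfl
  | cons x p ih => simpa [List.cons_lt_cons_iff] using ih

theorem le_lcpLength_iff {m : ℕ} {s t : List ℕ} :
    m ≤ lcpLength s t ↔ m ≤ s.length ∧ m ≤ t.length ∧ s.take m = t.take m := by
  induction m generalizing s t with
  | zero => simp
  | succ m ih =>
    cases s with
    | nil => simp [lcpLength]
    | cons a s =>
      cases t with
      | nil => simp [lcpLength]
      | cons b t =>
        by_cases h : a = b
        · simp [lcpLength, h, ih]
        · simp [lcpLength, h]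

theorem lcpLength_of_prefix {p s t : List ℕ} (hs : p <+: s) (ht : p <+: t) :
    p.length ≤ lcpLength s t :=
  le_lcpLength_iff.2 ⟨hs.length_le, ht.length_le,
    by rw [← List.prefix_iff_eq_take.1 hs, ← List.prefix_iff_eq_take.1 ht]⟩

theorem prefix_iff_of_le_lcpLength {p s t : List ℕ} (h : p.length ≤ lcpLength s t) :
    p <+: s ↔ p <+: t := by
  rw [List.prefix_iff_eq_take, List.prefix_iff_eq_take, (le_lcpLength_iff.1 h).2.2]

@[simp] theorem length_lcpArray (T : List ℕ) : (lcpArray T).length = T.length - 1 := by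
  simp [lcpArray]

theorem lcp_eq {i : ℕ} (h : i + 1 < T.length) :
    lcp T i = lcpLength (T.drop (sa T i)) (T.drop (sa T (i + 1))) := by
  have : i < T.length - 1 := by omega
  simp [lcp, lcpArray, sa, this]

/-! ### Suffix ranges -/

theorem mem_suffixRange {p : List ℕ} {j : ℕ} :
    j ∈ suffixRange p T ↔ j < T.length ∧ p <+: T.drop (sa T j) := by
  simp only [suffixRange, occurrences, Finset.mem_filter, Finset.mem_range]
  exact ⟨fun h => ⟨h.1, h.2.2⟩, fun h => ⟨h.1, sa_lt h.1, h.2⟩⟩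

theorem infix_of_prefix_drop {p : List ℕ} {i : ℕ} (h : p <+: T.drop i) : p <:+: T :=
  h.isInfix.trans (List.drop_suffix _ _).isInfix

theorem exists_mem_suffixRange {p : List ℕ} (hp : p ≠ []) (h : p <:+: T) :
    ∃ j, j ∈ suffixRange p T := by
  obtain ⟨s, t, rfl⟩ := h
  have hlt : s.length < (s ++ p ++ t).length := by
    have := List.length_pos_iff.2 hp
    simp; omega
  exact ⟨isa _ s.length, mem_suffixRange.2 ⟨isa_lt hlt, by rw [sa_isa hlt]; simp⟩⟩

theorem IsSuffixRange.mem_iff {p : List ℕ} {l r j : ℕ} (h : IsSuffixRange p T l r) :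
    l ≤ j ∧ j < r ↔ j < T.length ∧ p <+: T.drop (sa T j) := by
  rw [← mem_suffixRange, h.1, Finset.mem_Ico]

theorem IsSuffixRange.lt_iff {p : List ℕ} {l r : ℕ} (hp : p ≠ []) (h : IsSuffixRange p T l r) :
    l < r ↔ p <:+: T := by
  constructor
  · intro hlr
    exact infix_of_prefix_drop (h.mem_iff.1 ⟨le_rfl, hlr⟩).2
  · intro hi
    obtain ⟨j, hj⟩ := exists_mem_suffixRange hp hi
    rw [h.1, Finset.mem_Ico] at hj
    omega

theorem IsSuffixRange.le_length {p : List ℕ} {l r : ℕ} (hp : p ≠ [])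
    (h : IsSuffixRange p T l r) : r ≤ T.length := by
  by_cases hi : p <:+: T
  · have hlr := (h.lt_iff hp).2 hi
    have := (h.mem_iff (j := r - 1)).1 ⟨by omega, by omega⟩
    omega
  · simp [h.2 hi]

theorem isSuffixRange_of_lt {p : List ℕ} {l r : ℕ} (hlr : l < r)
    (h : ∀ j, l ≤ j ∧ j < r ↔ j < T.length ∧ p <+: T.drop (sa T j)) : IsSuffixRange p T l r := by
  refine ⟨?_, fun hn => absurd (infix_of_prefix_drop ((h l).1 ⟨le_rfl, hlr⟩).2) hn⟩
  ext j
  rw [Finset.mem_Ico, h, mem_suffixRange]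

theorem isSuffixRange_zero {p : List ℕ} (h : ¬ p <:+: T) : IsSuffixRange p T 0 0 := by
  refine ⟨?_, fun _ => ⟨rfl, rfl⟩⟩
  ext j
  simp only [mem_suffixRange, Finset.Ico_self, Finset.notMem_empty, iff_false]
  exact fun hj => h (infix_of_prefix_drop hj.2)

theorem card_occurrences (p : List ℕ) (T : List ℕ) :
    (occurrences p T).card = (suffixRange p T).card := by
  symm
  refine Finset.card_bij (fun j _ => sa T j) ?_ ?_ ?_
  · intro j hj
    obtain ⟨h1, h2⟩ := mem_suffixRange.1 hj
    simpa [occurrences] using ⟨sa_lt h1, h2⟩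
  · intro i hi j hj hij
    have h1 := (mem_suffixRange.1 hi).1
    have h2 := (mem_suffixRange.1 hj).1
    by_contra hne
    rcases Nat.lt_or_gt_of_ne hne with h | h
    · exact absurd (drop_sa_lt h h2) (by rw [hij]; exact lt_irrefl _)
    · exact absurd (drop_sa_lt h h1) (by rw [hij]; exact lt_irrefl _)
  · intro i hi
    simp only [occurrences, Finset.mem_filter, Finset.mem_range] at hi
    exact ⟨isa T i, mem_suffixRange.2 ⟨isa_lt hi.1, by rw [sa_isa hi.1]; exact hi.2⟩, sa_isa hi.1⟩

theorem IsSuffixRange.card {p : List ℕ} {l r : ℕ} (h : IsSuffixRange p T l r) :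
    (occurrences p T).card = r - l := by
  rw [card_occurrences, h.1, Nat.card_Ico]

/-- The suffix range of a string around the rank of one of its occurrences is delimited by the
nearest entries of the lcp array that are smaller than the length of the string. -/
theorem isSuffixRange_of_lcp {p : List ℕ} {j l r : ℕ} (hj : p <+: T.drop (sa T j))
    (hlj : l ≤ j) (hjr : j < r) (hr : r ≤ T.length)
    (hmid : ∀ i, l ≤ i → i + 1 < r → p.length ≤ lcp T i)
    (hleft : l = 0 ∨ lcp T (l - 1) < p.length)
    (hright : r = T.length ∨ lcp T (r - 1) < p.length) : IsSuffixRange p T l r := by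
  refine isSuffixRange_of_lt (hlj.trans_lt hjr) fun i => ?_
  have hstep : ∀ i, l ≤ i → i + 1 < r →
      (p <+: T.drop (sa T i) ↔ p <+: T.drop (sa T (i + 1))) := by
    intro i h1 h2
    apply prefix_iff_of_le_lcpLength
    rw [← lcp_eq (by omega)]
    exact hmid i h1 h2
  have hall : ∀ k, l + k < r → (p <+: T.drop (sa T l) ↔ p <+: T.drop (sa T (l + k))) := by
    intro k
    induction k with
    | zero => simp
    | succ k ih =>
      intro hk
      rw [ih (by omega), hstep (l + k) (by omega) (by omega)]
      rfl
  have hl : p <+: T.drop (sa T l) := by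
    rw [hall (j - l) (by omega), Nat.add_sub_cancel' hlj]
    exact hj
  have hin : ∀ i, l ≤ i → i < r → p <+: T.drop (sa T i) := by
    intro i h1 h2
    have := (hall (i - l) (by omega)).1 hl
    rwa [Nat.add_sub_cancel' h1] at this
  constructor
  · rintro ⟨h1, h2⟩
    exact ⟨by omega, hin i h1 h2⟩
  · rintro ⟨h1, h2⟩
    constructor
    -- A rank below `l` with prefix `p` would, by convexity, give `p` to the suffix of rank `l - 1`
    -- too. The suffixes of ranks `l - 1` and `l` would then share `p`, against `hleft`. The right
    -- end is symmetric.
    · by_contra! hlt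
      have hp := prefix_of_le_of_le h2 hl (drop_sa_le (show i ≤ l - 1 by omega) (by omega))
        (drop_sa_le (show l - 1 ≤ l by omega) (by omega))
      have := lcpLength_of_prefix hp
        (by rwa [show l - 1 + 1 = l by omega] : p <+: T.drop (sa T (l - 1 + 1)))
      rw [← lcp_eq (by omega)] at this
      omega
    · by_contra! hlt
      have hr1 := hin (r - 1) (by omega) (by omega)
      have hp := prefix_of_le_of_le hr1 h2 (drop_sa_le (show r - 1 ≤ r by omega) (by omega))
        (drop_sa_le hlt h1)
      have := lcpLength_of_prefix hr1
        (by rwa [show r - 1 + 1 = r by omega] : p <+: T.drop (sa T (r - 1 + 1)))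
      rw [← lcp_eq (by omega)] at this
      omega

/-- The search key for extensions of a string of length `m`: the rank, counted from one, of what
follows the first `m` characters of the suffix of rank `j`. -/
def extKey (T : List ℕ) (m j : ℕ) : ℕ :=
  if sa T j + m < T.length then isa T (sa T j + m) + 1 else 0

/-- The first character of the suffix of rank `j`. -/
def charKey (T : List ℕ) (j : ℕ) : ℕ := T.getD (sa T j) 0

theorem drop_of_prefix_drop {p : List ℕ} {i : ℕ} (h : p <+: T.drop i) :
    T.drop i = p ++ T.drop (i + p.length) := by
  obtain ⟨t, ht⟩ := h
  rw [← List.drop_drop, ← ht]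
  simp

/-- Cancelling the common prefix `p` turns the order of the suffixes into the order of their
remainders. The empty remainder is the least, which is why its key is `0` and the true ranks are
shifted by one. -/
theorem extKey_mono {p : List ℕ} {l r : ℕ} (h : IsSuffixRange p T l r) {i j : ℕ} (hi : l ≤ i)
    (hij : i ≤ j) (hj : j < r) : extKey T p.length i ≤ extKey T p.length j := by
  rcases hij.eq_or_lt with rfl | hlt
  · exact le_rfl
  obtain ⟨hi1, hi2⟩ := h.mem_iff.1 ⟨hi, by omega⟩
  obtain ⟨hj1, hj2⟩ := h.mem_iff.1 ⟨hi.trans hij, hj⟩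
  have := drop_sa_lt hlt hj1
  rw [drop_of_prefix_drop hi2, drop_of_prefix_drop hj2, append_lt_append_left_iff] at this
  unfold extKey
  split_ifs with h1 h2
  · exact Nat.succ_le_succ (isa_lt_isa h1 h2 this).le
  · rw [List.drop_eq_nil_of_le (not_lt.1 h2)] at this
    simp at this
  · exact Nat.zero_le _
  · exact le_rfl

/-- An occurrence of `p ++ q` is an occurrence of `p` whose remainder has its rank in the range of
`q`. The shift by one keeps key `0` (nothing follows `p`) outside the searched interval. If `q` does
not occur, the interval `[1, 1)` is empty, so this case needs no separate treatment. -/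
theorem append_prefix_iff {p q : List ℕ} {lp rp l r j : ℕ} (hq : q ≠ [])
    (h : IsSuffixRange p T lp rp) (hr : IsSuffixRange q T l r) :
    (j < T.length ∧ p ++ q <+: T.drop (sa T j)) ↔
      (lp ≤ j ∧ j < rp) ∧ l + 1 ≤ extKey T p.length j ∧ extKey T p.length j < r + 1 := by
  have key : ∀ j, p <+: T.drop (sa T j) → (p ++ q <+: T.drop (sa T j) ↔
      l + 1 ≤ extKey T p.length j ∧ extKey T p.length j < r + 1) := by
    intro j hj
    rw [drop_of_prefix_drop hj, List.prefix_append_right_inj, extKey]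
    split_ifs with h1
    · rw [Nat.add_lt_add_iff_right, Nat.add_le_add_iff_right, hr.mem_iff, sa_isa h1]
      exact ⟨fun h => ⟨isa_lt h1, h⟩, fun h => h.2⟩
    · rw [List.drop_eq_nil_of_le (not_lt.1 h1)]
      simp [hq]
  constructor
  · rintro ⟨h1, h2⟩
    have hp := (List.prefix_append p q).trans h2
    exact ⟨h.mem_iff.2 ⟨h1, hp⟩, (key j hp).1 h2⟩
  · rintro ⟨h1, h2⟩
    obtain ⟨h3, h4⟩ := h.mem_iff.1 h1
    exact ⟨h3, (key j h4).2 h2⟩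

theorem singleton_prefix_drop_iff {c i : ℕ} (hi : i < T.length) :
    [c] <+: T.drop i ↔ T.getD i 0 = c := by
  rw [List.drop_eq_getElem_cons hi]
  rw [List.cons_prefix_cons]
  simp [hi, eq_comm]

theorem charKey_mono {i j : ℕ} (hij : i ≤ j) (hj : j < T.length) : charKey T i ≤ charKey T j := by
  have h := drop_sa_le hij hj
  have h1 := sa_lt (hij.trans_lt hj)
  have h2 := sa_lt hj
  rw [List.drop_eq_getElem_cons h1, List.drop_eq_getElem_cons h2, cons_le_cons_iff_lex] at h
  simp only [charKey, List.getD_eq_getElem?_getD, List.getElem?_eq_getElem h1,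
    List.getElem?_eq_getElem h2, Option.getD_some]
  omega

theorem singleton_prefix_iff {c j : ℕ} :
    (j < T.length ∧ [c] <+: T.drop (sa T j)) ↔
      (0 ≤ j ∧ j < T.length) ∧ c ≤ charKey T j ∧ charKey T j < c + 1 := by
  constructor
  · rintro ⟨h1, h2⟩
    rw [singleton_prefix_drop_iff (sa_lt h1)] at h2
    exact ⟨⟨Nat.zero_le _, h1⟩, by rw [charKey, h2]; omega⟩
  · rintro ⟨⟨-, h1⟩, h2⟩
    refine ⟨h1, (singleton_prefix_drop_iff (sa_lt h1)).2 ?_⟩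
    rw [← charKey]
    omega

/-! ### Weakest preconditions -/

/-- The value of variable `i`. -/
def lookup : List Val → ℕ → Option Val
  | [], _ => none
  | v :: _, 0 => some v
  | _ :: env, i + 1 => lookup env i

theorem lookup_eq (env : List Val) (i : ℕ) : lookup env i = env[i]? := by
  induction env generalizing i with
  | nil => simp [lookup]
  | cons v env ih => cases i <;> simp [lookup, ih]

/-- Function `f` of the program, called with the argument `a`, returns a value `v` after `t`
steps such that `Φ v t`. -/
def Calls (prog : Program) (arr : ArrayName → List ℕ) (f : ℕ) (a : Val) (Φ : Val → ℕ → Prop) :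
    Prop :=
  ∃ v t, Runs prog arr f a v t ∧ Φ v t

theorem Calls.mono {prog : Program} {arr : ArrayName → List ℕ} {f : ℕ} {a : Val}
    {Φ Ψ : Val → ℕ → Prop} (h : Calls prog arr f a Φ) (hm : ∀ v t, Φ v t → Ψ v t) :
    Calls prog arr f a Ψ :=
  let ⟨v, t, hr, hv⟩ := h
  ⟨v, t, hr, hm v t hv⟩

/-- The weakest precondition of the evaluation of an expression: it ensures that the expression
evaluates to a value `v` in `t` steps such that `Φ v t`. -/
def wp (prog : Program) (arr : ArrayName → List ℕ) :
    Expr → List Val → (Val → ℕ → Prop) → Prop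
  | .var i, env, Φ => match lookup env i with
    | some v => Φ v 1
    | none => False
  | .lit n, _, Φ => Φ (.num n) 1
  | .pair e₁ e₂, env, Φ =>
    wp prog arr e₁ env fun v₁ t₁ => wp prog arr e₂ env fun v₂ t₂ => Φ (.pair v₁ v₂) (t₁ + t₂ + 1)
  | .fst e, env, Φ => wp prog arr e env fun v t => match v with
    | .pair a _ => Φ a (t + 1)
    | .num _ => False
  | .snd e, env, Φ => wp prog arr e env fun v t => match v with
    | .pair _ b => Φ b (t + 1)
    | .num _ => False
  | .add e₁ e₂, env, Φ => wp prog arr e₁ env fun v₁ t₁ => match v₁ with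
    | .num m => wp prog arr e₂ env fun v₂ t₂ => match v₂ with
      | .num n => Φ (.num (m + n)) (t₁ + t₂ + 1)
      | .pair _ _ => False
    | .pair _ _ => False
  | .sub e₁ e₂, env, Φ => wp prog arr e₁ env fun v₁ t₁ => match v₁ with
    | .num m => wp prog arr e₂ env fun v₂ t₂ => match v₂ with
      | .num n => Φ (.num (m - n)) (t₁ + t₂ + 1)
      | .pair _ _ => False
    | .pair _ _ => False
  | .half e, env, Φ => wp prog arr e env fun v t => match v with
    | .num n => Φ (.num (n / 2)) (t + 1)
    | .pair _ _ => False
  | .len A, _, Φ => Φ (.num (arr A).length) 1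
  | .read A e, env, Φ => wp prog arr e env fun v t => match v with
    | .num i => match (arr A)[i]? with
      | some x => Φ (.num x) (t + 1)
      | none => False
    | .pair _ _ => False
  | .ifLt e₁ e₂ e₃ e₄, env, Φ => wp prog arr e₁ env fun v₁ t₁ => match v₁ with
    | .num m => wp prog arr e₂ env fun v₂ t₂ => match v₂ with
      | .num n =>
        (m < n → wp prog arr e₃ env fun v t => Φ v (t₁ + t₂ + t + 1)) ∧
        (¬ m < n → wp prog arr e₄ env fun v t => Φ v (t₁ + t₂ + t + 1))
      | .pair _ _ => False
    | .pair _ _ => False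
  | .ifNum e₁ e₂ e₃, env, Φ => wp prog arr e₁ env fun v₁ t₁ => match v₁ with
    | .num _ => wp prog arr e₂ env fun v t => Φ v (t₁ + t + 1)
    | .pair _ _ => wp prog arr e₃ env fun v t => Φ v (t₁ + t + 1)
  | .letIn e₁ e₂, env, Φ => wp prog arr e₁ env fun v₁ t₁ =>
    wp prog arr e₂ (v₁ :: env) fun v t => Φ v (t₁ + t + 1)
  | .call f e, env, Φ => wp prog arr e env fun a t₁ =>
    Calls prog arr f a fun v t => Φ v (t₁ + t + 1)

/-- Soundness of `wp`. The postcondition receives the exact step count with the value, so unfolding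
`wp` on a function body leaves arithmetic about time, and one `Calls` goal for each call. -/
theorem exists_eval_of_wp {prog : Program} {arr : ArrayName → List ℕ} {e : Expr} {env : List Val}
    {Φ : Val → ℕ → Prop} (h : wp prog arr e env Φ) :
    ∃ v t, Eval prog arr env e v t ∧ Φ v t := by
  induction e generalizing env Φ with
  | var i =>
    simp only [wp, lookup_eq] at h
    split at h
    · exact ⟨_, _, .var ‹_›, h⟩
    · exact h.elim
  | lit n => exact ⟨_, _, .lit n, h⟩
  | pair e₁ e₂ ih₁ ih₂ =>
    obtain ⟨v₁, t₁, h₁, h⟩ := ih₁ h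
    obtain ⟨v₂, t₂, h₂, h⟩ := ih₂ h
    exact ⟨_, _, .pair h₁ h₂, h⟩
  | fst e ih =>
    obtain ⟨_ | ⟨a, b⟩, t, h₁, h⟩ := ih h
    · exact h.elim
    · exact ⟨_, _, .fst h₁, h⟩
  | snd e ih =>
    obtain ⟨_ | ⟨a, b⟩, t, h₁, h⟩ := ih h
    · exact h.elim
    · exact ⟨_, _, .snd h₁, h⟩
  | add e₁ e₂ ih₁ ih₂ =>
    obtain ⟨m | _, t₁, h₁, h⟩ := ih₁ h
    · obtain ⟨n | _, t₂, h₂, h⟩ := ih₂ h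
      · exact ⟨_, _, .add h₁ h₂, h⟩
      · exact h.elim
    · exact h.elim
  | sub e₁ e₂ ih₁ ih₂ =>
    obtain ⟨m | _, t₁, h₁, h⟩ := ih₁ h
    · obtain ⟨n | _, t₂, h₂, h⟩ := ih₂ h
      · exact ⟨_, _, .sub h₁ h₂, h⟩
      · exact h.elim
    · exact h.elim
  | half e ih =>
    obtain ⟨m | _, t₁, h₁, h⟩ := ih h
    · exact ⟨_, _, .half h₁, h⟩
    · exact h.elim
  | len A => exact ⟨_, _, .len A, h⟩
  | read A e ih =>
    obtain ⟨m | _, t₁, h₁, h⟩ := ih h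
    · dsimp only at h
      split at h
      · exact ⟨_, _, .read h₁ ‹_›, h⟩
      · exact h.elim
    · exact h.elim
  | ifLt e₁ e₂ e₃ e₄ ih₁ ih₂ ih₃ ih₄ =>
    obtain ⟨m | _, t₁, h₁, h⟩ := ih₁ h
    · obtain ⟨n | _, t₂, h₂, h⟩ := ih₂ h
      · by_cases hlt : m < n
        · obtain ⟨v, t, h₃, h⟩ := ih₃ (h.1 hlt)
          exact ⟨_, _, .ifLt_true h₁ h₂ hlt h₃, h⟩
        · obtain ⟨v, t, h₃, h⟩ := ih₄ (h.2 hlt)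
          exact ⟨_, _, .ifLt_false h₁ h₂ hlt h₃, h⟩
      · exact h.elim
    · exact h.elim
  | ifNum e₁ e₂ e₃ ih₁ ih₂ ih₃ =>
    obtain ⟨m | _, t₁, h₁, h⟩ := ih₁ h
    · obtain ⟨v, t, h₂, h⟩ := ih₂ h
      exact ⟨_, _, .ifNum_num h₁ h₂, h⟩
    · obtain ⟨v, t, h₂, h⟩ := ih₃ h
      exact ⟨_, _, .ifNum_pair h₁ h₂, h⟩
  | letIn e₁ e₂ ih₁ ih₂ =>
    obtain ⟨v₁, t₁, h₁, h⟩ := ih₁ h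
    obtain ⟨v₂, t₂, h₂, h⟩ := ih₂ h
    exact ⟨_, _, .letIn h₁ h₂, h⟩
  | call f e ih =>
    obtain ⟨a, t₁, h₁, v, t, ⟨body, hf, h₂⟩, h⟩ := ih h
    exact ⟨_, _, .call h₁ hf h₂, h⟩

theorem calls_of_wp {prog : Program} {arr : ArrayName → List ℕ} {f : ℕ} {a : Val} {body : Expr}
    {Φ : Val → ℕ → Prop} (hf : prog[f]? = some body) (h : wp prog arr body [a] Φ) :
    Calls prog arr f a Φ :=
  let ⟨v, t, he, hv⟩ := exists_eval_of_wp h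
  ⟨v, t, ⟨body, hf, he⟩, hv⟩

/-! ### The program -/

/-- The search key of a rank. The argument is `(x, j)`: if `x` is a number, the key is
`extKey T x j`, otherwise it is `charKey T j`. -/
def keyBody : Expr :=
  .ifNum (.fst (.var 0))
    (.letIn (.add (.read .sa (.snd (.var 0))) (.fst (.var 0)))
      (.ifLt (.var 0) (.len .text) (.add (.read .isa (.var 0)) (.lit 1)) (.lit 0)))
    (.read .text (.read .sa (.snd (.var 0))))

/-- Binary search. The argument is `(a, x, lo, hi)`; the result is the first rank in `[lo, hi)`
with a key at least `a`, or `hi`. -/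
def searchBody : Expr :=
  .ifLt (.fst (.snd (.snd (.var 0)))) (.snd (.snd (.snd (.var 0))))
    (.letIn (.half (.add (.fst (.snd (.snd (.var 0)))) (.snd (.snd (.snd (.var 0))))))
      (.ifLt (.call 0 (.pair (.fst (.snd (.var 1))) (.var 0))) (.fst (.var 1))
        (.call 1 (.pair (.fst (.var 1)) (.pair (.fst (.snd (.var 1)))
          (.pair (.add (.var 0) (.lit 1)) (.snd (.snd (.snd (.var 1))))))))
        (.call 1 (.pair (.fst (.var 1)) (.pair (.fst (.snd (.var 1)))
          (.pair (.fst (.snd (.snd (.var 1)))) (.var 0)))))))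
    (.fst (.snd (.snd (.var 0))))

/-- The ranks in an interval with keys in an interval. The argument is `((a, b), x, lo, hi)`. -/
def keyRangeBody : Expr :=
  .letIn (.call 1 (.pair (.fst (.fst (.var 0))) (.snd (.var 0))))
    (.letIn (.call 1 (.pair (.snd (.fst (.var 1))) (.pair (.fst (.snd (.var 1)))
        (.pair (.var 0) (.snd (.snd (.snd (.var 1))))))))
      (.ifLt (.var 1) (.var 0) (.pair (.var 1) (.var 0)) (.pair (.lit 0) (.lit 0))))

/-- The record of a character. -/
def charRecordBody : Expr :=
  .letIn (.call 2 (.pair (.pair (.var 0) (.add (.var 0) (.lit 1)))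
      (.pair (.pair (.lit 0) (.lit 0)) (.pair (.lit 0) (.len .text)))))
    (.pair (.lit 1) (.pair (.fst (.var 0)) (.pair (.snd (.var 0)) (.var 1))))

/-- The record of the concatenation of two parts. -/
def concatBody : Expr :=
  .letIn (.call 2 (.pair
      (.pair (.add (.fst (.snd (.snd (.var 0)))) (.lit 1))
        (.add (.fst (.snd (.snd (.snd (.var 0))))) (.lit 1)))
      (.pair (.fst (.fst (.var 0)))
        (.pair (.fst (.snd (.fst (.var 0)))) (.fst (.snd (.snd (.fst (.var 0)))))))))
    (.pair (.add (.fst (.fst (.var 1))) (.fst (.snd (.var 1))))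
      (.pair (.fst (.var 0)) (.pair (.snd (.var 0)) (.snd (.snd (.snd (.fst (.var 1))))))))

/-- The first entry less than `m` in the lcp array below node `k` of the segment tree. The
argument is `(m, k)`. -/
def descendLeftBody : Expr :=
  .ifLt (.snd (.var 0)) (.half (.len .lcpMin))
    (.letIn (.add (.snd (.var 0)) (.snd (.var 0)))
      (.ifLt (.read .lcpMin (.var 0)) (.fst (.var 1))
        (.call 5 (.pair (.fst (.var 1)) (.var 0)))
        (.call 5 (.pair (.fst (.var 1)) (.add (.var 0) (.lit 1))))))
    (.sub (.snd (.var 0)) (.half (.len .lcpMin)))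

/-- One more than the position of the last entry less than `m` in the lcp array below node `k` of
the segment tree. The argument is `(m, k)`. -/
def descendRightBody : Expr :=
  .ifLt (.snd (.var 0)) (.half (.len .lcpMin))
    (.letIn (.add (.snd (.var 0)) (.snd (.var 0)))
      (.ifLt (.read .lcpMin (.add (.var 0) (.lit 1))) (.fst (.var 1))
        (.call 6 (.pair (.fst (.var 1)) (.add (.var 0) (.lit 1))))
        (.call 6 (.pair (.fst (.var 1)) (.var 0)))))
    (.add (.sub (.snd (.var 0)) (.half (.len .lcpMin))) (.lit 1))

/-- The first entry less than `m` in the lcp array from the start of the block of node `k` on.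
The argument is `(m, k, w)`, where the nodes at the level of `k` start with `w`. -/
def nextBody : Expr :=
  .ifLt (.read .lcpMin (.fst (.snd (.var 0)))) (.fst (.var 0))
    (.call 5 (.pair (.fst (.var 0)) (.fst (.snd (.var 0)))))
    (.letIn (.add (.fst (.snd (.var 0))) (.lit 1))
      (.ifLt (.var 0) (.add (.snd (.snd (.var 1))) (.snd (.snd (.var 1))))
        (.letIn (.half (.var 0))
          (.ifLt (.add (.var 0) (.var 0)) (.var 1)
            (.call 7 (.pair (.fst (.var 2)) (.pair (.var 1) (.snd (.snd (.var 2))))))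
            (.call 7 (.pair (.fst (.var 2)) (.pair (.var 0) (.half (.snd (.snd (.var 2)))))))))
        (.len .lcp)))

/-- One more than the position of the last entry less than `m` in the lcp array up to the end of
the block of node `k`, or `0`. The argument is `(m, k, w)`, where the nodes at the level of `k`
start with `w`. -/
def prevBody : Expr :=
  .ifLt (.read .lcpMin (.fst (.snd (.var 0)))) (.fst (.var 0))
    (.call 6 (.pair (.fst (.var 0)) (.fst (.snd (.var 0)))))
    (.ifLt (.snd (.snd (.var 0))) (.fst (.snd (.var 0)))
      (.letIn (.sub (.fst (.snd (.var 0))) (.lit 1))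
        (.letIn (.half (.var 0))
          (.ifLt (.add (.var 0) (.var 0)) (.var 1)
            (.call 8 (.pair (.fst (.var 2)) (.pair (.var 0) (.half (.snd (.snd (.var 2)))))))
            (.call 8 (.pair (.fst (.var 2)) (.pair (.var 1) (.snd (.snd (.var 2)))))))))
      (.lit 0))

/-- The suffix range of the first `m` characters of the suffix of rank `j`. The argument is
`(j, m)`. -/
def prefixRangeBody : Expr :=
  .letIn (.half (.len .lcpMin))
    (.pair
      (.ifLt (.lit 0) (.fst (.var 1))
        (.call 8 (.pair (.snd (.var 1))
          (.pair (.sub (.add (.var 0) (.fst (.var 1))) (.lit 1)) (.var 0))))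
        (.lit 0))
      (.ifLt (.fst (.var 1)) (.len .lcp)
        (.letIn (.call 7 (.pair (.snd (.var 1))
            (.pair (.add (.var 0) (.fst (.var 1))) (.var 0))))
          (.add (.ifLt (.var 0) (.len .lcp) (.var 0) (.len .lcp)) (.lit 1)))
        (.add (.fst (.var 1)) (.lit 1))))

/-- The record of the substring of length `m` at offset `o` of a part. The argument is
`(part, o, m)`. -/
def subRecordBody : Expr :=
  .ifLt (.lit 0) (.snd (.snd (.var 0)))
    (.ifLt (.snd (.snd (.var 0))) (.fst (.fst (.var 0)))
      (.letIn (.add (.read .sa (.fst (.snd (.fst (.var 0))))) (.fst (.snd (.var 0))))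
        (.letIn (.call 9 (.pair (.read .isa (.var 0)) (.snd (.snd (.var 1)))))
          (.pair (.snd (.snd (.var 2)))
            (.pair (.fst (.var 0)) (.pair (.snd (.var 0)) (.read .text (.var 1)))))))
      (.fst (.var 0)))
    (.pair (.lit 0) (.pair (.lit 0) (.pair (.lit 0) (.lit 0))))

/-- The height of a tree. -/
def heightBody : Expr := .ifNum (.var 0) (.lit 0) (.fst (.var 0))

/-- The total length of the parts of a tree. -/
def sizeBody : Expr := .ifNum (.var 0) (.lit 0) (.fst (.snd (.var 0)))

/-- The height of the tree `e`. -/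
def heightExpr (e : Expr) : Expr := .call 24 e

/-- The total length of the parts of the tree `e`. -/
def sizeExpr (e : Expr) : Expr := .call 25 e

/-- A new node. The argument is `(l, p, r)`. -/
def nodeBody : Expr :=
  .letIn (heightExpr (.fst (.var 0)))
    (.letIn (heightExpr (.snd (.snd (.var 1))))
      (.pair (.add (.ifLt (.var 1) (.var 0) (.var 0) (.var 1)) (.lit 1))
        (.pair
          (.add (.add (sizeExpr (.fst (.var 2))) (.fst (.fst (.snd (.var 2)))))
            (sizeExpr (.snd (.snd (.var 2)))))
          (.pair (.fst (.snd (.var 2))) (.pair (.fst (.var 2)) (.snd (.snd (.var 2))))))))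

/-- The part of a node. -/
def partExpr (e : Expr) : Expr := .fst (.snd (.snd e))

/-- The left subtree of a node. -/
def leftExpr (e : Expr) : Expr := .fst (.snd (.snd (.snd e)))

/-- The right subtree of a node. -/
def rightExpr (e : Expr) : Expr := .snd (.snd (.snd (.snd e)))

/-- A new node, built from its components. -/
def nodeExpr (l p r : Expr) : Expr := .call 11 (.pair l (.pair p r))

/-- A new node, rebalanced. The argument is `(l, p, r)`. -/
def balanceBody : Expr :=
  .letIn (.fst (.var 0))
    (.letIn (.fst (.snd (.var 1)))
      (.letIn (.snd (.snd (.var 2)))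
        (.ifLt (.add (heightExpr (.var 0)) (.lit 1)) (heightExpr (.var 2))
          (.ifLt (heightExpr (leftExpr (.var 2))) (heightExpr (rightExpr (.var 2)))
            (.letIn (rightExpr (.var 2))
              (nodeExpr (nodeExpr (leftExpr (.var 3)) (partExpr (.var 3)) (leftExpr (.var 0)))
                (partExpr (.var 0)) (nodeExpr (rightExpr (.var 0)) (.var 2) (.var 1))))
            (nodeExpr (leftExpr (.var 2)) (partExpr (.var 2))
              (nodeExpr (rightExpr (.var 2)) (.var 1) (.var 0))))
          (.ifLt (.add (heightExpr (.var 2)) (.lit 1)) (heightExpr (.var 0))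
            (.ifLt (heightExpr (rightExpr (.var 0))) (heightExpr (leftExpr (.var 0)))
              (.letIn (leftExpr (.var 0))
                (nodeExpr (nodeExpr (.var 3) (.var 2) (leftExpr (.var 0)))
                  (partExpr (.var 0))
                  (nodeExpr (rightExpr (.var 0)) (partExpr (.var 1)) (rightExpr (.var 1)))))
              (nodeExpr (nodeExpr (.var 2) (.var 1) (leftExpr (.var 0)))
                (partExpr (.var 0)) (rightExpr (.var 0))))
            (nodeExpr (.var 2) (.var 1) (.var 0))))))

/-- Insertion of a part at a position. The argument is `(x, s, tree)`. -/
def insertPartBody : Expr :=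
  .letIn (.snd (.snd (.var 0)))
    (.letIn (.fst (.snd (.var 1)))
      (.ifNum (.var 1) (nodeExpr (.lit 0) (.fst (.var 2)) (.lit 0))
        (.ifLt (sizeExpr (leftExpr (.var 1))) (.var 0)
          (.call 12 (.pair (leftExpr (.var 1)) (.pair (partExpr (.var 1))
            (.call 13 (.pair (.fst (.var 2)) (.pair
              (.sub (.var 0) (.add (sizeExpr (leftExpr (.var 1))) (.fst (partExpr (.var 1)))))
              (rightExpr (.var 1))))))))
          (.call 12 (.pair
            (.call 13 (.pair (.fst (.var 2)) (.pair (.var 0) (leftExpr (.var 1)))))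
            (.pair (partExpr (.var 1)) (rightExpr (.var 1))))))))

/-- Removal of the first part of a nonempty tree. The result is `(part, tree)`. -/
def popFirstBody : Expr :=
  .ifNum (leftExpr (.var 0)) (.pair (partExpr (.var 0)) (rightExpr (.var 0)))
    (.letIn (.call 14 (leftExpr (.var 0)))
      (.pair (.fst (.var 0))
        (.call 12 (.pair (.snd (.var 0)) (.pair (partExpr (.var 1)) (rightExpr (.var 1)))))))

/-- The concatenation of two trees of almost equal heights. The argument is `(l, r)`. -/
def glueBody : Expr :=
  .ifNum (.snd (.var 0)) (.fst (.var 0))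
    (.letIn (.call 14 (.snd (.var 0)))
      (.call 12 (.pair (.fst (.var 1)) (.var 0))))

/-- Removal of the part around a position. The argument is `(s, tree)`, the result is
`(part, offset, tree)`. -/
def removePartBody : Expr :=
  .letIn (.snd (.var 0))
    (.letIn (sizeExpr (leftExpr (.var 0)))
      (.ifLt (.fst (.var 2)) (.var 0)
        (.letIn (.call 16 (.pair (.fst (.var 2)) (leftExpr (.var 1))))
          (.pair (.fst (.var 0)) (.pair (.fst (.snd (.var 0)))
            (.call 12 (.pair (.snd (.snd (.var 0)))
              (.pair (partExpr (.var 2)) (rightExpr (.var 2))))))))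
        (.ifLt (.fst (.var 2)) (.add (.var 0) (.fst (partExpr (.var 1))))
          (.pair (partExpr (.var 1)) (.pair (.sub (.fst (.var 2)) (.var 0))
            (.call 15 (.pair (leftExpr (.var 1)) (rightExpr (.var 1))))))
          (.letIn (.call 16 (.pair
              (.sub (.fst (.var 2)) (.add (.var 0) (.fst (partExpr (.var 1)))))
              (rightExpr (.var 1))))
            (.pair (.fst (.var 0)) (.pair (.fst (.snd (.var 0)))
              (.call 12 (.pair (leftExpr (.var 2))
                (.pair (partExpr (.var 2)) (.snd (.snd (.var 0))))))))))))

/-- Extension of a partial result `(cur, s, tree)` by a part `q`: the part is merged with the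
pending part `cur` if their concatenation occurs in the text; otherwise `cur` is inserted into the
tree, at position `s`, and `q` becomes the pending part. The argument is `(q, cur, s, tree)`. -/
def extendBody : Expr :=
  .letIn (.snd (.var 0))
    (.letIn (.fst (.var 1))
      (.ifLt (.lit 0) (.fst (.var 0))
        (.ifLt (.lit 0) (.fst (.fst (.var 1)))
          (.letIn (.call 4 (.pair (.fst (.var 1)) (.var 0)))
            (.ifLt (.fst (.snd (.var 0))) (.fst (.snd (.snd (.var 0))))
              (.pair (.var 0) (.snd (.var 2)))
              (.pair (.var 1) (.pair (.add (.fst (.snd (.var 2))) (.fst (.fst (.var 2))))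
                (.call 13 (.var 2))))))
          (.pair (.var 0) (.snd (.var 1))))
        (.var 1)))

/-- The partial result that starts with the part that ends at position `s`. The argument is
`(s, tree)`. -/
def startBody : Expr :=
  .ifLt (.lit 0) (.fst (.var 0))
    (.letIn (.call 16 (.pair (.sub (.fst (.var 0)) (.lit 1)) (.snd (.var 0))))
      (.pair (.fst (.var 0))
        (.pair (.sub (.fst (.var 1)) (.fst (.fst (.var 0)))) (.snd (.snd (.var 0))))))
    (.pair (.pair (.lit 0) (.pair (.lit 0) (.pair (.lit 0) (.lit 0)))) (.var 0))

/-- The tree of a partial result whose pending part is complete. The argument is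
`(cur, s, tree)`. -/
def closeBody : Expr :=
  .ifLt (.lit 0) (.fst (.fst (.var 0))) (.call 13 (.var 0)) (.snd (.snd (.var 0)))

/-- The tree of a partial result. The argument is `(cur, s, tree)`. -/
def finishBody : Expr :=
  .ifLt (.fst (.snd (.var 0))) (sizeExpr (.snd (.snd (.var 0))))
    (.letIn (.call 16 (.snd (.var 0)))
      (.call 19 (.call 17 (.pair (.fst (.var 0))
        (.pair (.fst (.var 1)) (.pair (.fst (.snd (.var 1))) (.snd (.snd (.var 0)))))))))
    (.call 19 (.var 0))

/-- Insertion of a character. The argument is `(i, c, tree)`. -/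
def insertBody : Expr :=
  .letIn (.snd (.snd (.var 0)))
    (.ifLt (.fst (.var 1)) (sizeExpr (.var 0))
      (.letIn (.call 16 (.pair (.fst (.var 1)) (.var 0)))
        (.letIn (.fst (.snd (.var 0)))
          (.letIn (.call 18 (.pair (.sub (.fst (.var 3)) (.var 0)) (.snd (.snd (.var 1)))))
            (.letIn (.call 17 (.pair
                (.call 10 (.pair (.fst (.var 2)) (.pair (.lit 0) (.var 1)))) (.var 0)))
              (.letIn (.call 17 (.pair (.call 3 (.fst (.snd (.var 5)))) (.var 0)))
                (.call 20 (.call 17 (.pair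
                  (.call 10 (.pair (.fst (.var 4)) (.pair (.var 3)
                    (.sub (.fst (.fst (.var 4))) (.var 3)))))
                  (.var 0)))))))))
      (.call 20 (.call 17 (.pair (.call 3 (.fst (.snd (.var 1))))
        (.call 18 (.pair (.fst (.var 1)) (.var 0)))))))

/-- Deletion of a character. The argument is `(i, tree)`. -/
def deleteBody : Expr :=
  .letIn (.call 16 (.var 0))
    (.letIn (.fst (.snd (.var 0)))
      (.letIn (.call 18 (.pair (.sub (.fst (.var 2)) (.var 0)) (.snd (.snd (.var 1)))))
        (.letIn (.call 17 (.pair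
            (.call 10 (.pair (.fst (.var 2)) (.pair (.lit 0) (.var 1)))) (.var 0)))
          (.call 20 (.call 17 (.pair
            (.call 10 (.pair (.fst (.var 3)) (.pair (.add (.var 2) (.lit 1))
              (.sub (.fst (.fst (.var 3))) (.add (.var 2) (.lit 1))))))
            (.var 0)))))))

/-- The number of occurrences. The argument is the tree. -/
def countBody : Expr :=
  .ifNum (.var 0) (.len .text)
    (.ifNum (leftExpr (.var 0))
      (.ifNum (rightExpr (.var 0))
        (.sub (.fst (.snd (.snd (partExpr (.var 0))))) (.fst (.snd (partExpr (.var 0)))))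
        (.lit 0))
      (.lit 0))

/-- The program. -/
def dynProg : Program :=
  [keyBody, searchBody, keyRangeBody, charRecordBody, concatBody, descendLeftBody,
    descendRightBody, nextBody, prevBody, prefixRangeBody, subRecordBody, nodeBody, balanceBody,
    insertPartBody, popFirstBody, glueBody, removePartBody, extendBody, startBody, closeBody,
    finishBody, insertBody, deleteBody, countBody,
    heightBody, sizeBody]

/-! ### Binary search -/

/-- Function `f` of the program, called on the text `T` with the argument `a`, returns a value `v`
with `Φ v` in at most `n` steps. -/
def Computes (T : List ℕ) (f : ℕ) (a : Val) (n : ℕ) (Φ : Val → Prop) : Prop :=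
  Calls dynProg (textArrays T) f a fun v t => t ≤ n ∧ Φ v

theorem Computes.bind {f : ℕ} {a : Val} {n : ℕ} {Φ : Val → Prop} {Ψ : Val → ℕ → Prop}
    (h : Computes T f a n Φ) (hm : ∀ v t, t ≤ n → Φ v → Ψ v t) :
    Calls dynProg (textArrays T) f a Ψ :=
  Calls.mono h fun v t hv => hm v t hv.1 hv.2

theorem text_getElem? {i : ℕ} (h : i < T.length) : T[i]? = some (T.getD i 0) := by
  simp [h]

theorem computes_extKey {j m : ℕ} (hj : j < T.length) :
    Computes T 0 (.pair (.num m) (.num j)) 30 fun v => v = .num (extKey T m j) := by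
  refine calls_of_wp (body := keyBody) rfl ?_
  simp only [keyBody, wp, lookup, textArrays, suffixArray_getElem? hj]
  constructor
  · intro h
    simp only [inverseSuffixArray_getElem? h, extKey, if_pos h]
    exact ⟨by omega, trivial⟩
  · intro h
    simp only [extKey, if_neg h]
    exact ⟨by omega, trivial⟩

theorem computes_charKey {j : ℕ} {a b : Val} (hj : j < T.length) :
    Computes T 0 (.pair (.pair a b) (.num j)) 30 fun v => v = .num (charKey T j) := by
  refine calls_of_wp (body := keyBody) rfl ?_
  simp only [keyBody, wp, lookup, textArrays, suffixArray_getElem? hj, text_getElem? (sa_lt hj),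
    charKey]
  exact ⟨by omega, trivial⟩

/-- The keys `key` are computed from `x` and increase weakly in the interval `[lo, hi)`. -/
structure IsKey (T : List ℕ) (x : Val) (key : ℕ → ℕ) (lo hi : ℕ) : Prop where
  computes : ∀ j, lo ≤ j → j < hi →
    Computes T 0 (.pair x (.num j)) 30 fun v => v = .num (key j)
  mono : ∀ i j, lo ≤ i → i ≤ j → j < hi → key i ≤ key j

theorem IsKey.subinterval {x : Val} {key : ℕ → ℕ} {lo hi lo' hi' : ℕ} (h : IsKey T x key lo hi)
    (hl : lo ≤ lo') (hh : hi' ≤ hi) : IsKey T x key lo' hi' :=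
  ⟨fun j h1 h2 => h.computes j (hl.trans h1) (h2.trans_le hh),
    fun i j h1 h2 h3 => h.mono i j (hl.trans h1) h2 (h3.trans_le hh)⟩

/-- Monotonicity lets one comparison at the midpoint decide a whole half, so each round lowers the
exponent `e` by one. The invariant is stated for keys outside the remaining interval through the
recursive result, and a round costs less than `100`. -/
theorem computes_search {x : Val} {key : ℕ → ℕ} {a e lo hi : ℕ} (hk : IsKey T x key lo hi)
    (hle : lo ≤ hi) (he : hi - lo < 2 ^ e) :
    Computes T 1 (.pair (.num a) (.pair x (.pair (.num lo) (.num hi)))) (100 * (e + 1)) fun v =>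
      ∃ r, v = .num r ∧ lo ≤ r ∧ r ≤ hi ∧ (∀ i, lo ≤ i → i < r → key i < a) ∧
        ∀ i, r ≤ i → i < hi → a ≤ key i := by
  induction e generalizing lo hi with
  | zero =>
    refine calls_of_wp (body := searchBody) rfl ?_
    simp only [searchBody, wp, lookup]
    have : lo = hi := by omega
    refine ⟨fun h => by omega, fun _ => ⟨by omega, lo, rfl, le_rfl, hle, ?_, ?_⟩⟩ <;>
    · intro i _ _
      omega
  | succ e ih =>
    rw [pow_succ] at he
    refine calls_of_wp (body := searchBody) rfl ?_
    simp only [searchBody, wp, lookup]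
    refine ⟨fun h => ?_, fun h => ⟨by omega, lo, rfl, le_rfl, hle, ?_, ?_⟩⟩
    · refine (hk.computes ((lo + hi) / 2) (by omega) (by omega)).bind ?_
      rintro _ t ht rfl
      refine ⟨fun hlt => ?_, fun hlt => ?_⟩
      · refine (ih (hk.subinterval (lo' := (lo + hi) / 2 + 1) (by omega) le_rfl) (by omega)
          (by omega)).bind ?_
        rintro _ t' ht' ⟨r, rfl, h1, h2, h3, h4⟩
        refine ⟨by omega, r, rfl, by omega, h2, fun i hi1 hi2 => ?_, h4⟩
        by_cases hi : i ≤ (lo + hi) / 2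
        · exact (hk.mono _ _ hi1 hi (by omega)).trans_lt hlt
        · exact h3 i (by omega) hi2
      · refine (ih (hk.subinterval (hi' := (lo + hi) / 2) le_rfl (by omega)) (by omega)
          (by omega)).bind ?_
        rintro _ t' ht' ⟨r, rfl, h1, h2, h3, h4⟩
        refine ⟨by omega, r, rfl, h1, by omega, h3, fun i hi1 hi2 => ?_⟩
        by_cases hi : (lo + hi) / 2 ≤ i
        · exact (not_lt.1 hlt).trans (hk.mono _ _ (by omega) hi hi2)
        · exact h4 i hi1 (by omega)
    · intro i _ _
      omega
    · intro i _ _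
      omega

theorem computes_keyRange {x : Val} {key : ℕ → ℕ} {a b lo hi : ℕ} {p : List ℕ}
    (hk : IsKey T x key lo hi) (hle : lo ≤ hi) (hhi : hi ≤ T.length)
    (hp : ∀ j, (j < T.length ∧ p <+: T.drop (sa T j)) ↔
      (lo ≤ j ∧ j < hi) ∧ a ≤ key j ∧ key j < b) (hne : p ≠ []) :
    Computes T 2 (.pair (.pair (.num a) (.num b)) (.pair x (.pair (.num lo) (.num hi))))
      (500 * (Nat.log 2 T.length + 1)) fun v =>
        ∃ l r, v = .pair (.num l) (.num r) ∧ IsSuffixRange p T l r := by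
  have he := Nat.lt_pow_succ_log_self one_lt_two T.length
  refine calls_of_wp (body := keyRangeBody) rfl ?_
  simp only [keyRangeBody, wp, lookup]
  refine (computes_search (a := a) hk hle
    ((Nat.sub_le _ _).trans_lt (hhi.trans_lt he))).bind ?_
  rintro _ t ht ⟨l, rfl, h1, h2, h3, h4⟩
  refine (computes_search (a := b) (hk.subinterval h1 le_rfl) h2
    ((Nat.sub_le _ _).trans_lt (hhi.trans_lt he))).bind ?_
  rintro _ t' ht' ⟨r, rfl, h5, h6, h7, h8⟩
  have hiff : ∀ j, l ≤ j ∧ j < r ↔ j < T.length ∧ p <+: T.drop (sa T j) := by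
    intro j
    rw [hp]
    constructor
    · rintro ⟨g1, g2⟩
      exact ⟨⟨by omega, by omega⟩, h4 j g1 (by omega), h7 j g1 g2⟩
    · rintro ⟨⟨g1, g2⟩, g3, g4⟩
      constructor
      · by_contra! hlt
        have := h3 j g1 hlt
        omega
      · by_contra! hlt
        have := h8 j hlt g2
        omega
  -- If the two searches meet, `p` does not occur; the program then returns `[0, 0)`, as the
  -- convention on suffix ranges demands.
  refine ⟨fun hlt => ⟨by omega, l, r, rfl, isSuffixRange_of_lt hlt hiff⟩,
    fun hlt => ⟨by omega, 0, 0, rfl, isSuffixRange_zero fun hi => ?_⟩⟩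
  obtain ⟨j, hj⟩ := exists_mem_suffixRange hne hi
  have := (hiff j).2 (mem_suffixRange.1 hj)
  omega

/-- The record of a part with the suffix range `[l, r)`. -/
def record (p : List ℕ) (l r : ℕ) : Val :=
  .pair (.num p.length) (.pair (.num l) (.pair (.num r) (.num (p.headD 0))))

theorem computes_charRecord (c : ℕ) :
    Computes T 3 (.num c) (600 * (Nat.log 2 T.length + 1)) fun v =>
      ∃ l r, v = record [c] l r ∧ IsSuffixRange [c] T l r := by
  refine calls_of_wp (body := charRecordBody) rfl ?_
  simp only [charRecordBody, wp, lookup]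
  -- Passing a pair in place of a length makes function `0` compute `charKey`. This key is monotone
  -- on all ranks.
  have hk : IsKey T (.pair (.num 0) (.num 0)) (charKey T) 0 T.length :=
    ⟨fun j _ h => computes_charKey h, fun i j _ h h' => charKey_mono h h'⟩
  refine (computes_keyRange hk (Nat.zero_le _) le_rfl (fun j => singleton_prefix_iff (c := c))
    (by simp)).bind ?_
  rintro _ t ht ⟨l, r, rfl, h⟩
  exact ⟨by omega, l, r, rfl, h⟩

theorem IsSuffixRange.le {p : List ℕ} {l r : ℕ} (hp : p ≠ []) (h : IsSuffixRange p T l r) :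
    l ≤ r := by
  by_cases hi : p <:+: T
  · exact ((h.lt_iff hp).2 hi).le
  · simp [h.2 hi]

/-- If `p` does not occur, its range `[0, 0)` makes the search trivial. The program therefore does
not test which of the two parts occur in the text. -/
theorem computes_concat {p q : List ℕ} {lp rp lq rq : ℕ} (hp : p ≠ []) (hq : q ≠ [])
    (hpr : IsSuffixRange p T lp rp) (hqr : IsSuffixRange q T lq rq) :
    Computes T 4 (.pair (record p lp rp) (record q lq rq)) (600 * (Nat.log 2 T.length + 1)) fun v =>
      ∃ l r, v = record (p ++ q) l r ∧ IsSuffixRange (p ++ q) T l r := by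
  refine calls_of_wp (body := concatBody) rfl ?_
  simp only [concatBody, wp, lookup, record]
  have hk : IsKey T (.num p.length) (extKey T p.length) lp rp :=
    ⟨fun j h1 h2 => computes_extKey (h2.trans_le (hpr.le_length hp)),
      fun i j h1 h2 h3 => extKey_mono hpr h1 h2 h3⟩
  refine (computes_keyRange hk (hpr.le hp) (hpr.le_length hp)
    (fun j => append_prefix_iff hq hpr hqr) (by simp [hp])).bind ?_
  rintro _ t ht ⟨l, r, rfl, h⟩
  refine ⟨by omega, l, r, ?_, h⟩
  cases p with
  | nil => exact absurd rfl hp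
  | cons x p => simp [Nat.add_right_comm]

/-! ### The segment tree -/

/-- The depth of the segment tree. -/
def treeDepth (T : List ℕ) : ℕ := Nat.clog 2 (T.length - 1)

/-- The value of the segment tree at the node number `b` of height `e`. -/
def blockMin (T : List ℕ) (e b : ℕ) : ℕ :=
  (((lcpArray T).drop (b * 2 ^ e)).take (2 ^ e)).min?.getD 0

/-- Gives the program the index of the first leaf, a power of two, in constant time and without
multiplication. -/
theorem half_length_minTree :
    (minTree (lcpArray T)).length / 2 = 2 ^ treeDepth T := by
  simp [minTree, treeDepth]

/-- Writing a node as `2 ^ d + b` separates its depth from its block number. Doubling and halving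
the index then move between levels, and adding or subtracting one moves along a level. -/
theorem minTree_getElem? {d e b : ℕ} (hde : d + e = treeDepth T) (hb : b < 2 ^ d) :
    (minTree (lcpArray T))[2 ^ d + b]? = some (blockMin T e b) := by
  have hlog : Nat.log 2 (2 ^ d + b) = d := by
    rw [Nat.log_eq_iff (by simp)]
    rw [pow_succ]
    omega
  have hpow : 2 ^ treeDepth T / 2 ^ d = 2 ^ e := by
    rw [← hde, pow_add, Nat.mul_div_cancel_left _ (by positivity)]
  have hlt : 2 ^ d + b < 2 * 2 ^ treeDepth T := by
    have : 2 ^ d ≤ 2 ^ treeDepth T := Nat.pow_le_pow_right (by simp) (by omega)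
    omega
  rw [treeDepth] at hpow hlt
  simp [minTree, hlt, hlog, hpow, blockMin]

theorem lcp_eq_zero {i : ℕ} (h : T.length ≤ i + 1) : lcp T i = 0 := by
  have : (lcpArray T).length ≤ i := by
    rw [length_lcpArray]
    omega
  simp [lcp, List.getElem?_eq_none this]

theorem lcp_mem_block {e b i : ℕ} (h1 : b * 2 ^ e ≤ i) (h2 : i < b * 2 ^ e + 2 ^ e)
    (h3 : i + 1 < T.length) :
    lcp T i ∈ ((lcpArray T).drop (b * 2 ^ e)).take (2 ^ e) := by
  have h4 : i < (lcpArray T).length := by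
    rw [length_lcpArray]
    omega
  refine List.mem_of_getElem? (i := i - b * 2 ^ e) ?_
  rw [List.getElem?_take_of_lt (by omega), List.getElem?_drop, Nat.add_sub_cancel' h1]
  simp [lcp, List.getElem?_eq_getElem h4]

/-- Since `m` is positive and an empty block has the value `0`, a block with value at least `m`
really meets the array. -/
theorem le_blockMin {m e b : ℕ} (hm : 0 < m) (h : m ≤ blockMin T e b) :
    b * 2 ^ e + 1 < T.length ∧
      ∀ i, b * 2 ^ e ≤ i → i < b * 2 ^ e + 2 ^ e → i + 1 < T.length → m ≤ lcp T i := by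
  unfold blockMin at h
  cases hx : (((lcpArray T).drop (b * 2 ^ e)).take (2 ^ e)).min? with
  | none =>
    rw [hx] at h
    simp at h
    omega
  | some x =>
    rw [hx, Option.getD_some] at h
    obtain ⟨h1, h2⟩ := List.min?_eq_some_iff.1 hx
    refine ⟨?_, fun i h3 h4 h5 => h.trans (h2 _ (lcp_mem_block h3 h4 h5))⟩
    by_contra! hle
    have hl : (lcpArray T).length ≤ b * 2 ^ e := by
      rw [length_lcpArray]
      omega
    rw [List.drop_eq_nil_of_le hl] at h1
    simp at h1

/-- For an empty block the witness is its first position, where `lcp` is continued by zero. The last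
disjunct records that only this case can lead outside the array. -/
theorem blockMin_lt {m e b : ℕ} (h : blockMin T e b < m) :
    ∃ i, b * 2 ^ e ≤ i ∧ i < b * 2 ^ e + 2 ^ e ∧ lcp T i < m ∧
      (i + 1 < T.length ∨ T.length ≤ b * 2 ^ e + 1) := by
  unfold blockMin at h
  have hpos : 0 < 2 ^ e := by positivity
  cases hx : (((lcpArray T).drop (b * 2 ^ e)).take (2 ^ e)).min? with
  | none =>
    rw [hx] at h
    rw [List.min?_eq_none_iff, List.take_eq_nil_iff, List.drop_eq_nil_iff, length_lcpArray] at hx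
    refine ⟨b * 2 ^ e, le_rfl, by omega, ?_, by omega⟩
    rw [lcp_eq_zero (by omega)]
    exact h
  | some x =>
    rw [hx, Option.getD_some] at h
    obtain ⟨i, hi⟩ := List.mem_iff_getElem?.1 (List.min?_eq_some_iff.1 hx).1
    have hlt : i < 2 ^ e := by
      by_contra! hle
      rw [List.getElem?_take_eq_none hle] at hi
      simp at hi
    rw [List.getElem?_take_of_lt hlt, List.getElem?_drop] at hi
    have hlen := (List.getElem?_eq_some_iff.1 hi).1
    rw [length_lcpArray] at hlen
    refine ⟨b * 2 ^ e + i, by omega, by omega, ?_, by omega⟩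
    simpa [lcp, hi] using h

theorem blockMin_leaf (b : ℕ) : blockMin T 0 b = lcp T b := by
  by_cases hb : b < (lcpArray T).length
  · have h : ((lcpArray T).drop b).take 1 = [(lcpArray T)[b]] := by
      rw [List.drop_eq_getElem_cons hb]
      rfl
    simp [blockMin, lcp, h, List.getElem?_eq_getElem hb]
  · have hl := not_lt.1 hb
    simp [blockMin, lcp, List.getElem?_eq_none hl, List.drop_eq_nil_of_le hl]

theorem blockMin_right_lt {m e b : ℕ} (hm : 0 < m) (h : blockMin T (e + 1) b < m)
    (hl : m ≤ blockMin T e (2 * b)) : blockMin T e (2 * b + 1) < m := by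
  by_contra! hr
  obtain ⟨i, h1, h2, h3, h4⟩ := blockMin_lt h
  obtain ⟨g1, g2⟩ := le_blockMin hm hl
  obtain ⟨g3, g4⟩ := le_blockMin hm hr
  rw [show b * 2 ^ (e + 1) = 2 * b * 2 ^ e by ring] at h1 h2 h4
  rw [show (2 * b + 1) * 2 ^ e = 2 * b * 2 ^ e + 2 ^ e by ring] at g3 g4
  rw [pow_succ] at h2
  by_cases hi : i < 2 * b * 2 ^ e + 2 ^ e
  · have := g2 i h1 hi (by omega)
    omega
  · have := g4 i (by omega) (by omega) (by omega)
    omega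

/-- If the left child has no small entry, the right child must have one, so the descent never
backtracks. From an empty block it ends beyond the array, hence the guard `i + 1 < T.length`. -/
theorem computes_descendLeft {m d e b : ℕ} (hde : d + e = treeDepth T) (hb : b < 2 ^ d)
    (hm : 0 < m) (hlt : blockMin T e b < m) :
    Computes T 5 (.pair (.num m) (.num (2 ^ d + b))) (50 * (e + 1)) fun v =>
      ∃ r, v = .num r ∧ b * 2 ^ e ≤ r ∧
        (∀ i, b * 2 ^ e ≤ i → i < r → i + 1 < T.length → m ≤ lcp T i) ∧ lcp T r < m := by
  induction e generalizing d b with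
  | zero =>
    refine calls_of_wp (body := descendLeftBody) rfl ?_
    simp only [descendLeftBody, wp, lookup, textArrays, half_length_minTree, ← hde, add_zero,
      pow_zero, mul_one]
    refine ⟨fun h => by omega, fun _ => ⟨by omega, b, by rw [Nat.add_sub_cancel_left], le_rfl,
      fun i _ _ => by omega, ?_⟩⟩
    rwa [blockMin_leaf] at hlt
  | succ e ih =>
    have hk : 2 ^ d + b + (2 ^ d + b) = 2 ^ (d + 1) + 2 * b := by
      rw [pow_succ]
      omega
    have hb' : 2 * b + 1 < 2 ^ (d + 1) := by
      rw [pow_succ]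
      omega
    have hlt' : 2 ^ d + b < 2 ^ treeDepth T := by
      have : 2 ^ (d + 1) ≤ 2 ^ treeDepth T := Nat.pow_le_pow_right (by simp) (by omega)
      rw [pow_succ] at this
      omega
    have hs : b * 2 ^ (e + 1) = 2 * b * 2 ^ e := by ring
    refine calls_of_wp (body := descendLeftBody) rfl ?_
    simp only [descendLeftBody, wp, lookup, textArrays, half_length_minTree, hk,
      minTree_getElem? (show d + 1 + e = treeDepth T by omega) (show 2 * b < 2 ^ (d + 1) by omega)]
    refine ⟨fun _ => ⟨fun h => ?_, fun h => ?_⟩, fun h => absurd hlt' h⟩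
    · refine (ih (by omega) (by omega) h).bind ?_
      rintro _ t ht ⟨r, rfl, h1, h2, h3⟩
      rw [hs]
      exact ⟨by omega, r, rfl, h1, h2, h3⟩
    · rw [add_assoc]
      refine (ih (by omega) hb' (blockMin_right_lt hm hlt (not_lt.1 h))).bind ?_
      rintro _ t ht ⟨r, rfl, h1, h2, h3⟩
      have h4 := (le_blockMin hm (not_lt.1 h)).2
      rw [show (2 * b + 1) * 2 ^ e = 2 * b * 2 ^ e + 2 ^ e by ring] at h1 h2
      rw [hs]
      refine ⟨by omega, r, rfl, (Nat.le_add_right _ _).trans h1, fun i g1 g2 g3 => ?_, h3⟩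
      by_cases hi : i < 2 * b * 2 ^ e + 2 ^ e
      · exact h4 i g1 hi g3
      · exact h2 i (by omega) g2 g3

/-- Here the right child is preferred. The block is required to lie inside the array: in a cut-off
block the last small entry could be one of the zeros by which `lcp` is continued. -/
theorem computes_descendRight {m d e b : ℕ} (hde : d + e = treeDepth T) (hb : b < 2 ^ d)
    (hm : 0 < m) (hlt : blockMin T e b < m) (hfull : b * 2 ^ e + 2 ^ e + 1 ≤ T.length) :
    Computes T 6 (.pair (.num m) (.num (2 ^ d + b))) (50 * (e + 1)) fun v =>
      ∃ r, v = .num r ∧ r ≤ b * 2 ^ e + 2 ^ e ∧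
        (∀ i, r ≤ i → i < b * 2 ^ e + 2 ^ e → m ≤ lcp T i) ∧ lcp T (r - 1) < m := by
  induction e generalizing d b with
  | zero =>
    refine calls_of_wp (body := descendRightBody) rfl ?_
    simp only [descendRightBody, wp, lookup, textArrays, half_length_minTree, ← hde, add_zero,
      pow_zero, mul_one]
    refine ⟨fun h => by omega, fun _ => ⟨by omega, b + 1, by rw [Nat.add_sub_cancel_left], le_rfl,
      fun i _ _ => by omega, ?_⟩⟩
    rwa [blockMin_leaf] at hlt
  | succ e ih =>
    have hk : 2 ^ d + b + (2 ^ d + b) = 2 ^ (d + 1) + 2 * b := by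
      rw [pow_succ]
      omega
    have hb' : 2 * b + 1 < 2 ^ (d + 1) := by
      rw [pow_succ]
      omega
    have hlt' : 2 ^ d + b < 2 ^ treeDepth T := by
      have : 2 ^ (d + 1) ≤ 2 ^ treeDepth T := Nat.pow_le_pow_right (by simp) (by omega)
      rw [pow_succ] at this
      omega
    have hs : b * 2 ^ (e + 1) = 2 * b * 2 ^ e := by ring
    have hs' : (2 * b + 1) * 2 ^ e = 2 * b * 2 ^ e + 2 ^ e := by ring
    have he : 2 ^ (e + 1) = 2 ^ e + 2 ^ e := by ring
    have hpos : 0 < 2 ^ e := by positivity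
    rw [hs, he] at hfull
    refine calls_of_wp (body := descendRightBody) rfl ?_
    simp only [descendRightBody, wp, lookup, textArrays, half_length_minTree, hk,
      add_assoc (2 ^ (d + 1)) (2 * b) 1,
      minTree_getElem? (show d + 1 + e = treeDepth T by omega) hb']
    refine ⟨fun _ => ⟨fun h => ?_, fun h => ?_⟩, fun h => absurd hlt' h⟩
    · refine (ih (by omega) hb' h (by omega)).bind ?_
      rintro _ t ht ⟨r, rfl, h1, h2, h3⟩
      rw [hs, he]
      rw [hs'] at h1 h2
      exact ⟨by omega, r, rfl, by omega, fun i g1 g2 => h2 i g1 (by omega), h3⟩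
    · obtain ⟨g1, g2⟩ := le_blockMin hm (not_lt.1 h)
      rw [hs'] at g1 g2
      have hl : blockMin T e (2 * b) < m := by
        by_contra! hle
        exact h (blockMin_right_lt hm hlt hle)
      refine (ih (by omega) (by omega) hl (by omega)).bind ?_
      rintro _ t ht ⟨r, rfl, h1, h2, h3⟩
      rw [hs, he]
      refine ⟨by omega, r, rfl, by omega, fun i h4 h5 => ?_, h3⟩
      by_cases hi : i < 2 * b * 2 ^ e + 2 ^ e
      · exact h2 i h4 hi
      · exact g2 i (by omega) (by omega) (by omega)

/-- A block without small entries is skipped. If the next node is a right child, the walk stays on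
its level; if it is a left child, the walk goes up to the parent, whose block starts at the same
place. A step along the level is always followed by a move up, a descent or the end, so `2 * d + (1
- b % 2)` decreases and the walk has length linear in the depth. -/
theorem computes_next {m d e b μ : ℕ} (hde : d + e = treeDepth T) (hb : b < 2 ^ d)
    (hm : 0 < m) (hμ : 2 * d + (1 - b % 2) ≤ μ) :
    Computes T 7 (.pair (.num m) (.pair (.num (2 ^ d + b)) (.num (2 ^ d))))
      (50 * μ + 100 * (treeDepth T + 1)) fun v =>
      ∃ r, v = .num r ∧ b * 2 ^ e ≤ r ∧
        (∀ i, b * 2 ^ e ≤ i → i < r → i + 1 < T.length → m ≤ lcp T i) ∧ lcp T r < m := by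
  have hpos : 0 < 2 ^ e := by positivity
  induction μ using Nat.strong_induction_on generalizing d e b with
  | _ μ ih =>
    refine calls_of_wp (body := nextBody) rfl ?_
    simp only [nextBody, wp, lookup, textArrays, minTree_getElem? hde hb, length_lcpArray]
    refine ⟨fun h => ?_, fun h => ⟨fun h1 => ⟨fun h2 => ?_, fun h2 => ?_⟩, fun h1 => ?_⟩⟩
    · refine (computes_descendLeft hde hb hm h).bind ?_
      rintro _ t ht ⟨r, rfl, h1, h2, h3⟩
      exact ⟨by omega, r, rfl, h1, h2, h3⟩
    · obtain ⟨g1, g2⟩ := le_blockMin hm (not_lt.1 h)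
      have heven : b % 2 = 0 := by
        rcases d with - | d
        · omega
        · rw [pow_succ] at h2
          omega
      rw [add_assoc]
      refine (ih (2 * d) (by omega) hde (by omega) (by omega) hpos).bind ?_
      rintro _ t ht ⟨r, rfl, h3, h4, h5⟩
      rw [add_mul, one_mul] at h3 h4
      refine ⟨by omega, r, rfl, by omega, fun i k1 k2 k3 => ?_, h5⟩
      by_cases hi : i < b * 2 ^ e + 2 ^ e
      · exact g2 i k1 hi k3
      · exact h4 i (by omega) k2 k3
    · obtain ⟨g1, g2⟩ := le_blockMin hm (not_lt.1 h)
      obtain ⟨d, rfl⟩ : ∃ d', d = d' + 1 := ⟨d - 1, by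
        rcases d with - | d
        · omega
        · rfl⟩
      have hd : 2 ^ (d + 1) = 2 * 2 ^ d := by ring
      rw [hd] at hb h1 h2 ⊢
      obtain ⟨c, rfl⟩ : ∃ c, b = 2 * c + 1 := ⟨b / 2, by omega⟩
      rw [show (2 * 2 ^ d + (2 * c + 1) + 1) / 2 = 2 ^ d + (c + 1) by omega,
        show 2 * 2 ^ d / 2 = 2 ^ d by omega]
      refine (ih (2 * d + 1) (by omega) (e := e + 1) (by omega) (by omega) (by omega)
        (by positivity)).bind ?_
      rintro _ t ht ⟨r, rfl, h3, h4, h5⟩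
      rw [show (c + 1) * 2 ^ (e + 1) = (2 * c + 1) * 2 ^ e + 2 ^ e by ring] at h3 h4
      refine ⟨by omega, r, rfl, by omega, fun i k1 k2 k3 => ?_, h5⟩
      by_cases hi : i < (2 * c + 1) * 2 ^ e + 2 ^ e
      · exact g2 i k1 hi k3
      · exact h4 i (by omega) k2 k3
    · obtain ⟨g1, g2⟩ := le_blockMin hm (not_lt.1 h)
      -- The walk has left the last node of its level. The length of the lcp array is returned, a
      -- position where the continuation by zeros is below `m`.
      refine ⟨by omega, _, rfl, by omega, fun i k1 k2 k3 => g2 i k1 ?_ k3, ?_⟩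
      · have hall : T.length - 1 ≤ 2 ^ treeDepth T := Nat.le_pow_clog one_lt_two _
        rw [← hde, pow_add, show 2 ^ d = b + 1 by omega, add_mul, one_mul] at hall
        omega
      · rw [lcp_eq_zero (by omega)]
        exact hm

/-- The mirror walk. It goes up when the previous node is a right child, because the parent's block
then ends at the same place. Thus full blocks lead only to full blocks, and `hfull` is preserved. -/
theorem computes_prev {m d e b μ : ℕ} (hde : d + e = treeDepth T) (hb : b < 2 ^ d)
    (hm : 0 < m) (hμ : 2 * d + b % 2 ≤ μ) (hfull : b * 2 ^ e + 2 ^ e + 1 ≤ T.length) :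
    Computes T 8 (.pair (.num m) (.pair (.num (2 ^ d + b)) (.num (2 ^ d))))
      (50 * μ + 100 * (treeDepth T + 1)) fun v =>
      ∃ r, v = .num r ∧ r ≤ b * 2 ^ e + 2 ^ e ∧
        (∀ i, r ≤ i → i < b * 2 ^ e + 2 ^ e → m ≤ lcp T i) ∧
        (r = 0 ∨ lcp T (r - 1) < m) := by
  have hpos : 0 < 2 ^ e := by positivity
  induction μ using Nat.strong_induction_on generalizing d e b with
  | _ μ ih =>
    refine calls_of_wp (body := prevBody) rfl ?_
    simp only [prevBody, wp, lookup, textArrays, minTree_getElem? hde hb]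
    refine ⟨fun h => ?_, fun h => ⟨fun h1 => ⟨fun h2 => ?_, fun h2 => ?_⟩, fun h1 => ?_⟩⟩
    · refine (computes_descendRight hde hb hm h hfull).bind ?_
      rintro _ t ht ⟨r, rfl, h1, h2, h3⟩
      exact ⟨by omega, r, rfl, h1, h2, .inr h3⟩
    · obtain ⟨g1, g2⟩ := le_blockMin hm (not_lt.1 h)
      obtain ⟨d, rfl⟩ : ∃ d', d = d' + 1 := ⟨d - 1, by
        rcases d with - | d
        · omega
        · rfl⟩
      have hd : 2 ^ (d + 1) = 2 * 2 ^ d := by ring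
      rw [hd] at hb h1 h2 ⊢
      obtain ⟨c, rfl⟩ : ∃ c, b = 2 * c + 2 := ⟨b / 2 - 1, by omega⟩
      rw [show (2 * 2 ^ d + (2 * c + 2) - 1) / 2 = 2 ^ d + c by omega,
        show 2 * 2 ^ d / 2 = 2 ^ d by omega]
      have hend : c * 2 ^ (e + 1) + 2 ^ (e + 1) = (2 * c + 2) * 2 ^ e := by ring
      refine (ih (2 * d + 1) (by omega) (e := e + 1) (by omega) (by omega) (by omega)
        (by omega) (by positivity)).bind ?_
      rintro _ t ht ⟨r, rfl, h3, h4, h5⟩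
      rw [hend] at h3 h4
      refine ⟨by omega, r, rfl, by omega, fun i k1 k2 => ?_, h5⟩
      by_cases hi : i < (2 * c + 2) * 2 ^ e
      · exact h4 i k1 hi
      · exact g2 i (by omega) k2 (by omega)
    · obtain ⟨g1, g2⟩ := le_blockMin hm (not_lt.1 h)
      obtain ⟨c, rfl⟩ : ∃ c, b = c + 1 := ⟨b - 1, by omega⟩
      have heven : c % 2 = 0 := by
        rcases d with - | d
        · omega
        · rw [pow_succ] at h2
          omega
      rw [show 2 ^ d + (c + 1) - 1 = 2 ^ d + c by omega]
      have hend : (c + 1) * 2 ^ e = c * 2 ^ e + 2 ^ e := by ring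
      refine (ih (2 * d) (by omega) hde (by omega) (by omega) (by omega) hpos).bind ?_
      rintro _ t ht ⟨r, rfl, h3, h4, h5⟩
      rw [← hend] at h3 h4
      refine ⟨by omega, r, rfl, by omega, fun i k1 k2 => ?_, h5⟩
      by_cases hi : i < (c + 1) * 2 ^ e
      · exact h4 i k1 hi
      · exact g2 i (by omega) k2 (by omega)
    · obtain ⟨g1, g2⟩ := le_blockMin hm (not_lt.1 h)
      obtain rfl : b = 0 := by omega
      exact ⟨by omega, 0, rfl, by omega, fun i k1 k2 => g2 i (by omega) k2 (by omega), .inl rfl⟩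

theorem treeDepth_le (T : List ℕ) : treeDepth T ≤ Nat.log 2 T.length + 1 := by
  have := Nat.lt_pow_succ_log_self one_lt_two T.length
  exact (Nat.clog_le_iff_le_pow one_lt_two).2 ((Nat.sub_le _ _).trans this.le)

theorem computes_prefixRange {j : ℕ} {p : List ℕ} (hj : j < T.length) (hp : p ≠ [])
    (hpre : p <+: T.drop (sa T j)) :
    Computes T 9 (.pair (.num j) (.num p.length)) (1000 * (Nat.log 2 T.length + 1)) fun v =>
      ∃ l r, v = .pair (.num l) (.num r) ∧ IsSuffixRange p T l r := by
  have hm : 0 < p.length := List.length_pos_iff.2 hp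
  have hD := treeDepth_le T
  have hall : T.length - 1 ≤ 2 ^ treeDepth T := Nat.le_pow_clog one_lt_two _
  refine calls_of_wp (body := prefixRangeBody) rfl ?_
  simp only [prefixRangeBody, wp, lookup, textArrays, half_length_minTree, length_lcpArray]
  -- The two ends are computed independently, but being a suffix range involves both. The right end
  -- is therefore treated for an arbitrary valid left end. The search may stop beyond the array, and
  -- the program then cuts its result off at the length of the array.
  have right : ∀ l, l ≤ j → (∀ i, l ≤ i → i < j → p.length ≤ lcp T i) →
      (l = 0 ∨ lcp T (l - 1) < p.length) →
      (j < T.length - 1 → Computes T 7 (.pair (.num p.length)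
        (.pair (.num (2 ^ treeDepth T + j)) (.num (2 ^ treeDepth T))))
        (400 * (Nat.log 2 T.length + 1)) fun v => ∃ r, v = .num r ∧
          (r < T.length - 1 → IsSuffixRange p T l (r + 1)) ∧
          (¬ r < T.length - 1 → IsSuffixRange p T l (T.length - 1 + 1))) ∧
      (¬ j < T.length - 1 → IsSuffixRange p T l (j + 1)) := by
    intro l h1 h2 h3
    refine ⟨fun hlt => ?_, fun hge => ?_⟩
    · refine (computes_next (e := 0) (add_zero _) (hlt.trans_le hall) hm le_rfl).bind ?_
      rintro _ t ht ⟨r, rfl, h4, h5, h6⟩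
      rw [pow_zero, mul_one] at h4 h5
      have hmid : ∀ i, l ≤ i → i < r → i + 1 < T.length → p.length ≤ lcp T i := by
        intro i g1 g2 g3
        by_cases hi : i < j
        · exact h2 i g1 hi
        · exact h5 i (not_lt.1 hi) g2 g3
      refine ⟨by omega, r, rfl, fun hr => ?_, fun hr => ?_⟩
      · exact isSuffixRange_of_lcp hpre h1 (Nat.lt_succ_of_le h4) (by omega)
          (fun i g1 g2 => hmid i g1 (by omega) (by omega)) h3 (.inr h6)
      · exact isSuffixRange_of_lcp hpre h1 (by omega) (by omega)
          (fun i g1 g2 => hmid i g1 (by omega) (by omega)) h3 (.inl (by omega))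
    · exact isSuffixRange_of_lcp hpre h1 (Nat.lt_succ_self j) hj
        (fun i g1 g2 => h2 i g1 (by omega)) h3 (.inl (by omega))
  refine ⟨fun h0 => ?_, fun h0 => ?_⟩
  · rw [show 2 ^ treeDepth T + j - 1 = 2 ^ treeDepth T + (j - 1) by omega]
    refine (computes_prev (e := 0) (b := j - 1) (add_zero _) (by omega) hm le_rfl
      (by omega)).bind ?_
    rintro _ t ht ⟨l, rfl, h1, h2, h3⟩
    rw [pow_zero, mul_one, show j - 1 + 1 = j by omega] at h1 h2
    obtain ⟨hr1, hr2⟩ := right l h1 h2 h3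
    refine ⟨fun hlt => ?_, fun hge => ⟨by omega, l, _, rfl, hr2 hge⟩⟩
    refine (hr1 hlt).bind ?_
    rintro _ t' ht' ⟨r, rfl, h4, h5⟩
    exact ⟨fun hr => ⟨by omega, l, _, rfl, h4 hr⟩, fun hr => ⟨by omega, l, _, rfl, h5 hr⟩⟩
  · obtain ⟨hr1, hr2⟩ := right 0 (Nat.zero_le _) (fun i _ hi => by omega) (.inl rfl)
    refine ⟨fun hlt => ?_, fun hge => ⟨by omega, 0, _, rfl, hr2 hge⟩⟩
    refine (hr1 hlt).bind ?_
    rintro _ t' ht' ⟨r, rfl, h4, h5⟩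
    exact ⟨fun hr => ⟨by omega, 0, _, rfl, h4 hr⟩, fun hr => ⟨by omega, 0, _, rfl, h5 hr⟩⟩

/-! ### Parts -/

/-- A string that may be a part: it is not empty, and it is a substring of the text or a single
character that does not occur in the text. -/
def IsPart (T p : List ℕ) : Prop :=
  p ≠ [] ∧ (p <:+: T ∨ ∃ c, p = [c] ∧ c ∉ T)

/-- Allows a part to be cut anywhere: a single character absent from the text has no proper nonempty
substring. -/
theorem IsPart.of_infix {p q : List ℕ} (hp : IsPart T p) (hq : q ≠ []) (h : q <:+: p) :
    IsPart T q := by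
  refine ⟨hq, ?_⟩
  rcases hp.2 with hi | ⟨c, rfl, hc⟩
  · exact .inl (h.trans hi)
  · refine .inr ⟨c, h.eq_of_length_le ?_, hc⟩
    have := List.length_pos_iff.2 hq
    simpa [Nat.succ_le_iff] using this

theorem isPart_singleton (c : ℕ) : IsPart T [c] := by
  refine ⟨by simp, ?_⟩
  by_cases hc : c ∈ T
  · obtain ⟨s, t, rfl⟩ := List.append_of_mem hc
    exact .inl ⟨s, t, by simp⟩
  · exact .inr ⟨c, rfl, hc⟩

theorem computes_subRecord {p : List ℕ} {l r o m : ℕ} (hp : IsPart T p)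
    (hr : IsSuffixRange p T l r) (hom : o + m ≤ p.length) :
    Computes T 10 (.pair (record p l r) (.pair (.num o) (.num m)))
      (1100 * (Nat.log 2 T.length + 1)) fun v =>
      ∃ l' r', v = record ((p.drop o).take m) l' r' ∧
        ((p.drop o).take m ≠ [] → IsSuffixRange ((p.drop o).take m) T l' r') ∧
        ((p.drop o).take m = [] → l' = 0 ∧ r' = 0) := by
  refine calls_of_wp (body := subRecordBody) rfl ?_
  simp only [subRecordBody, wp, lookup, textArrays, record]
  set q := (p.drop o).take m with hq
  have hqlen : q.length = m := by
    simp [hq]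
    omega
  refine ⟨fun hm => ⟨fun hlt => ?_, fun hge => ?_⟩, fun hm => ?_⟩
  -- A nonempty proper piece exists only if `p` has at least two characters, so `p` occurs in the
  -- text and the first rank `l` of its range yields an occurrence.
  · have hinf : p <:+: T := by
      rcases hp.2 with h | ⟨c, rfl, -⟩
      · exact h
      · simp at hlt
        omega
    have hlr := (hr.lt_iff hp.1).2 hinf
    obtain ⟨h1, h2⟩ := hr.mem_iff.1 ⟨le_rfl, hlr⟩
    have hpos : sa T l + o < T.length := by
      have := h2.length_le
      rw [List.length_drop] at this
      omega
    have hqne : q ≠ [] := by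
      rw [← List.length_pos_iff, hqlen]
      exact hm
    have hqpre : q <+: T.drop (sa T l + o) := by
      rw [← List.drop_drop, hq]
      exact (List.take_prefix _ _).trans (h2.drop o)
    rw [← hqlen]
    simp only [suffixArray_getElem? h1, inverseSuffixArray_getElem? hpos, text_getElem? hpos]
    refine (computes_prefixRange (isa_lt hpos) hqne (by rwa [sa_isa hpos])).bind ?_
    rintro _ t ht ⟨l', r', rfl, h⟩
    refine ⟨by omega, l', r', ?_, fun _ => h, fun h => absurd h hqne⟩
    obtain ⟨x, q', hx⟩ := List.exists_cons_of_ne_nil hqne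
    rw [hx] at hqpre ⊢
    have := (singleton_prefix_drop_iff (c := x) hpos).1
      ((List.prefix_append [x] q').trans hqpre)
    rw [this]
    rfl
  -- The piece is the whole part, whose record is reused. The text could not be consulted here, as
  -- `p` may be a character absent from it.
  · obtain rfl : o = 0 := by omega
    have hqp : q = p := by
      rw [hq, List.drop_zero, List.take_of_length_le (by omega)]
    rw [hqp]
    exact ⟨by omega, l, r, rfl, fun _ => hr, fun h => absurd h hp.1⟩
  · have : q = [] := by
      rw [← List.length_eq_zero_iff, hqlen]
      omega
    rw [this]
    exact ⟨by omega, 0, 0, rfl, fun h => absurd rfl h, fun _ => ⟨rfl, rfl⟩⟩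

/-! ### Balanced trees of parts with their suffix ranges -/

/-- A part with the end points of its suffix range. -/
structure Item where
  /-- the part -/
  str : List ℕ
  /-- the first rank of the suffix range -/
  lo : ℕ
  /-- the end of the suffix range -/
  hi : ℕ

/-- The record of an item. -/
def Item.val (x : Item) : Val := record x.str x.lo x.hi

/-- The empty item. -/
def Item.empty : Item := ⟨[], 0, 0⟩

/-- The items of a tree, from left to right. -/
def items : BinaryTree Item → List Item
  | .nil => []
  | .node x l r => items l ++ x :: items r

/-- The total length of the parts of a tree. -/
def size : BinaryTree Item → ℕ
  | .nil => 0
  | .node x l r => size l + x.str.length + size r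

/-- The total length of a list of parts. -/
def totalLength (L : List Item) : ℕ := (L.map fun x => x.str.length).sum

@[simp] theorem totalLength_nil : totalLength [] = 0 := rfl

@[simp] theorem totalLength_cons (x : Item) (L : List Item) :
    totalLength (x :: L) = x.str.length + totalLength L := by simp [totalLength]

@[simp] theorem totalLength_append (L L' : List Item) :
    totalLength (L ++ L') = totalLength L + totalLength L' := by simp [totalLength]

theorem totalLength_items (t : BinaryTree Item) : totalLength (items t) = size t := by
  induction t with
  | nil => rfl
  | node x l r ihl ihr => simp [items, size, ihl, ihr, add_assoc]

/-- The height balance of a tree. -/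
def Balanced : BinaryTree Item → Prop
  | .nil => True
  | .node _ l r => l.height ≤ r.height + 1 ∧ r.height ≤ l.height + 1 ∧ Balanced l ∧ Balanced r

/-- The pointer structure of a tree. -/
def encode : BinaryTree Item → Val
  | .nil => .num 0
  | .node x l r => .pair (.num (max l.height r.height + 1))
      (.pair (.num (size l + x.str.length + size r)) (.pair x.val (.pair (encode l) (encode r))))

/-- Each child of a node is lower by at most two, so two levels double the bound. The part at the
root has length at least one, which pays for the `+ 1`. -/
theorem Balanced.pow_height_le {t : BinaryTree Item} (h : Balanced t)
    (hne : ∀ x ∈ items t, x.str ≠ []) : 2 ^ (t.height / 2) ≤ size t + 1 := by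
  induction t with
  | nil => simp [BinaryTree.height, size]
  | node x l r ihl ihr =>
    obtain ⟨h1, h2, hl, hr⟩ := h
    have ihl := ihl hl fun y hy => hne y (by simp [items, hy])
    have ihr := ihr hr fun y hy => hne y (by simp [items, hy])
    have hx := List.length_pos_iff.2 (hne x (by simp [items]))
    simp only [BinaryTree.height, size]
    rcases Nat.eq_zero_or_pos ((max l.height r.height + 1) / 2) with h0 | h0
    · rw [h0]
      simp
    · obtain ⟨k, hk⟩ : ∃ k, (max l.height r.height + 1) / 2 = k + 1 :=
        ⟨_, (Nat.sub_add_cancel h0).symm⟩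
      have hkl : 2 ^ k ≤ 2 ^ (l.height / 2) := Nat.pow_le_pow_right (by simp) (by omega)
      have hkr : 2 ^ k ≤ 2 ^ (r.height / 2) := Nat.pow_le_pow_right (by simp) (by omega)
      rw [hk, pow_succ]
      omega

/-- A node with rebalanced subtrees. -/
def balance (l : BinaryTree Item) (p : Item) (r : BinaryTree Item) : BinaryTree Item :=
  if r.height + 1 < l.height then
    match l with
    -- An unreachable value, like the other empty cases: a tree that is strictly higher than another
    -- is not empty.
    | .nil => .nil
    | .node q ll lr =>
      if ll.height < lr.height then
        match lr with
        | .nil => .nil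
        | .node x a b => .node x (.node q ll a) (.node p b r)
      else .node q ll (.node p lr r)
  else if l.height + 1 < r.height then
    match r with
    | .nil => .nil
    | .node q rl rr =>
      if rr.height < rl.height then
        match rl with
        | .nil => .nil
        | .node x a b => .node x (.node p l a) (.node q b rr)
      else .node q (.node p l rl) rr
  else .node p l r

theorem items_balance (l : BinaryTree Item) (p : Item) (r : BinaryTree Item) :
    items (balance l p r) = items l ++ p :: items r := by
  unfold balance
  split_ifs with h1 h2
  · rcases l with - | ⟨q, ll, lr⟩
    · simp [BinaryTree.height] at h1
    dsimp only
    split_ifs with h3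
    · rcases lr with - | ⟨x, a, b⟩
      · simp [BinaryTree.height] at h3
      simp [items]
    · simp [items]
  · rcases r with - | ⟨q, rl, rr⟩
    · simp [BinaryTree.height] at h2
    dsimp only
    split_ifs with h3
    · rcases rl with - | ⟨x, a, b⟩
      · simp [BinaryTree.height] at h3
      simp [items]
    · simp [items]
  · simp [items]

/-- A difference of two is what one changed subtree can cause. The last conjunct, the exact height
without rotation, is needed in the inductions for insertion and removal: the lower bound `max` alone
would lose one level at every node. -/
theorem Balanced.balance {l r : BinaryTree Item} {p : Item} (hl : Balanced l) (hr : Balanced r)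
    (h1 : l.height ≤ r.height + 2) (h2 : r.height ≤ l.height + 2) :
    Balanced (balance l p r) ∧ max l.height r.height ≤ (DynPattern.balance l p r).height ∧
      (DynPattern.balance l p r).height ≤ max l.height r.height + 1 ∧
      (l.height ≤ r.height + 1 → r.height ≤ l.height + 1 →
        (DynPattern.balance l p r).height = max l.height r.height + 1) := by
  unfold DynPattern.balance
  split_ifs with h3 h4
  · rcases l with - | ⟨q, ll, lr⟩
    · simp [BinaryTree.height] at h3
    dsimp only
    split_ifs with h5
    · rcases lr with - | ⟨x, a, b⟩
      · simp [BinaryTree.height] at h5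
      simp only [Balanced, BinaryTree.height] at *
      refine ⟨⟨?_, ?_, ⟨?_, ?_, hl.2.2.1, hl.2.2.2.2.2.1⟩, ?_, ?_, hl.2.2.2.2.2.2, hr⟩, ?_, ?_, ?_⟩
      all_goals omega
    · simp only [Balanced, BinaryTree.height] at *
      refine ⟨⟨?_, ?_, hl.2.2.1, ?_, ?_, hl.2.2.2, hr⟩, ?_, ?_, ?_⟩
      all_goals omega
  · rcases r with - | ⟨q, rl, rr⟩
    · simp [BinaryTree.height] at h4
    dsimp only
    split_ifs with h5
    · rcases rl with - | ⟨x, a, b⟩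
      · simp [BinaryTree.height] at h5
      simp only [Balanced, BinaryTree.height] at *
      refine ⟨⟨?_, ?_, ⟨?_, ?_, hl, hr.2.2.1.2.2.1⟩, ?_, ?_, hr.2.2.1.2.2.2, hr.2.2.2⟩, ?_, ?_, ?_⟩
      all_goals omega
    · simp only [Balanced, BinaryTree.height] at *
      refine ⟨⟨?_, ?_, ⟨?_, ?_, hl, hr.2.2.1⟩, hr.2.2.2⟩, ?_, ?_, ?_⟩
      all_goals omega
  · simp only [Balanced, BinaryTree.height]
    refine ⟨⟨?_, ?_, hl, hr⟩, ?_, ?_, fun _ _ => trivial⟩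
    all_goals omega

/-- Insertion of an item at a position. -/
def insertPart (x : Item) (s : ℕ) : BinaryTree Item → BinaryTree Item
  | .nil => .node x .nil .nil
  | .node p l r =>
    if size l < s then balance l p (insertPart x (s - (size l + p.str.length)) r)
    else balance (insertPart x s l) p r

theorem Balanced.insertPart {t : BinaryTree Item} (h : Balanced t) (x : Item) (s : ℕ) :
    Balanced (insertPart x s t) ∧ t.height ≤ (DynPattern.insertPart x s t).height ∧
      (DynPattern.insertPart x s t).height ≤ t.height + 1 := by
  induction t generalizing s with
  | nil => simp [DynPattern.insertPart, Balanced, BinaryTree.height]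
  | node p l r ihl ihr =>
    obtain ⟨h1, h2, hl, hr⟩ := h
    simp only [DynPattern.insertPart, BinaryTree.height]
    split_ifs with hs
    · obtain ⟨g1, g2, g3⟩ := ihr hr (s - (size l + p.str.length))
      obtain ⟨k1, k2, k3, k4⟩ := hl.balance (p := p) g1 (by omega) (by omega)
      exact ⟨k1, by omega, by omega⟩
    · obtain ⟨g1, g2, g3⟩ := ihl hl s
      obtain ⟨k1, k2, k3, k4⟩ := Balanced.balance (p := p) g1 hr (by omega) (by omega)
      exact ⟨k1, by omega, by omega⟩

/-- As parts are nonempty, the total length of `A` determines the place between `A` and `B`. At the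
boundary `s = size l` the descent goes left, which puts `x` after all items of `l` and before the
root. -/
theorem items_insertPart {t : BinaryTree Item} {x : Item} {A B : List Item}
    (hne : ∀ y ∈ items t, y.str ≠ []) (h : items t = A ++ B) :
    items (insertPart x (totalLength A) t) = A ++ x :: B := by
  induction t generalizing A B with
  | nil =>
    obtain ⟨rfl, rfl⟩ := List.append_eq_nil_iff.1 h.symm
    rfl
  | node p l r ihl ihr =>
    have hsize := totalLength_items l
    have hnl : ∀ y ∈ items l, y.str ≠ [] := fun y hy => hne y (by simp [items, hy])
    have hnr : ∀ y ∈ items r, y.str ≠ [] := fun y hy => hne y (by simp [items, hy])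
    have hp := List.length_pos_iff.2 (hne p (by simp [items]))
    have left : ∀ C, items l = A ++ C → B = C ++ p :: items r →
        items (insertPart x (totalLength A) (.node p l r)) = A ++ x :: B := by
      rintro C h1 rfl
      rw [h1, totalLength_append] at hsize
      rw [insertPart, if_neg (by omega), items_balance, ihl hnl h1]
      simp
    rw [items, List.append_eq_append_iff] at h
    rcases h with ⟨C, rfl, h2⟩ | ⟨C, h1, h2⟩
    · rcases C with - | ⟨q, C⟩
      · exact left [] (by simp) (by simpa using h2.symm)
      · obtain ⟨rfl, h3⟩ := List.cons.inj h2
        rw [totalLength_append, totalLength_cons, hsize, insertPart, if_pos (by omega),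
          items_balance, Nat.add_sub_add_left, Nat.add_sub_cancel_left, ihr hnr h3]
        simp
    · exact left C h1 h2

/-- Removal of the first item of a tree that is given by its root and subtrees. -/
def popFirst (p : Item) : BinaryTree Item → BinaryTree Item → Item × BinaryTree Item
  | .nil, r => (p, r)
  | .node q a b, r => ((popFirst q a b).1, balance (popFirst q a b).2 p r)

theorem items_popFirst (p : Item) (l r : BinaryTree Item) :
    (popFirst p l r).1 :: items (popFirst p l r).2 = items l ++ p :: items r := by
  induction l generalizing p r with
  | nil => rfl
  | node q a b iha ihb =>
    rw [popFirst, items_balance, ← List.cons_append, iha]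
    rfl

theorem Balanced.popFirst {p : Item} {l r : BinaryTree Item} (h : Balanced (.node p l r)) :
    Balanced (popFirst p l r).2 ∧
      (DynPattern.popFirst p l r).2.height ≤ (BinaryTree.node p l r).height ∧
      (BinaryTree.node p l r).height ≤ (DynPattern.popFirst p l r).2.height + 1 := by
  induction l generalizing p r with
  | nil =>
    obtain ⟨h1, h2, -, hr⟩ := h
    simp only [BinaryTree.height, DynPattern.popFirst] at *
    exact ⟨hr, by omega, by omega⟩
  | node q a b iha ihb =>
    obtain ⟨h1, h2, hl, hr⟩ := h
    obtain ⟨g1, g2, g3⟩ := iha hl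
    obtain ⟨k1, k2, k3, k4⟩ := Balanced.balance (p := p) g1 hr (by omega) (by omega)
    simp only [DynPattern.popFirst]
    rw [BinaryTree.height]
    exact ⟨k1, by omega, by omega⟩

/-- The concatenation of two trees. -/
def glue (l : BinaryTree Item) : BinaryTree Item → BinaryTree Item
  | .nil => l
  | .node q a b => balance l (popFirst q a b).1 (popFirst q a b).2

theorem items_glue (l r : BinaryTree Item) : items (glue l r) = items l ++ items r := by
  cases r with
  | nil => simp [glue, items]
  | node q a b => rw [glue, items_balance, items_popFirst, items]

/-- Popping lowers the right tree by at most one, so the heights differ by at most two, which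
`balance` tolerates. -/
theorem Balanced.glue {l r : BinaryTree Item} (hl : Balanced l) (hr : Balanced r)
    (h1 : l.height ≤ r.height + 1) (h2 : r.height ≤ l.height + 1) :
    Balanced (glue l r) ∧ (DynPattern.glue l r).height ≤ max l.height r.height + 1 ∧
      max l.height r.height ≤ (DynPattern.glue l r).height := by
  cases r with
  | nil => exact ⟨hl, by simp [DynPattern.glue], by simp [DynPattern.glue, BinaryTree.height]⟩
  | node q a b =>
    obtain ⟨g1, g2, g3⟩ := hr.popFirst
    obtain ⟨k1, k2, k3, k4⟩ :=
      hl.balance (p := (DynPattern.popFirst q a b).1) g1 (by omega) (by omega)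
    simp only [DynPattern.glue]
    exact ⟨k1, by omega, by omega⟩

/-- Removal of the item around a position. The result consists of the item, the offset of the
position, and the remaining tree. -/
def removePart (s : ℕ) : BinaryTree Item → Item × ℕ × BinaryTree Item
  | .nil => (Item.empty, 0, .nil)
  | .node p l r =>
    if s < size l then
      ((removePart s l).1, (removePart s l).2.1, balance (removePart s l).2.2 p r)
    else if s < size l + p.str.length then (p, s - size l, glue l r)
    else
      ((removePart (s - (size l + p.str.length)) r).1,
        (removePart (s - (size l + p.str.length)) r).2.1,
        balance l p (removePart (s - (size l + p.str.length)) r).2.2)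

theorem Balanced.removePart {t : BinaryTree Item} (h : Balanced t) (s : ℕ) :
    Balanced (removePart s t).2.2 ∧ (DynPattern.removePart s t).2.2.height ≤ t.height ∧
      t.height ≤ (DynPattern.removePart s t).2.2.height + 1 := by
  induction t generalizing s with
  | nil => simp [DynPattern.removePart, Balanced, BinaryTree.height]
  | node p l r ihl ihr =>
    obtain ⟨h1, h2, hl, hr⟩ := h
    simp only [DynPattern.removePart, BinaryTree.height]
    split_ifs with h3 h4
    · obtain ⟨g1, g2, g3⟩ := ihl hl s
      obtain ⟨k1, k2, k3, k4⟩ := Balanced.balance (p := p) g1 hr (by omega) (by omega)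
      exact ⟨k1, by dsimp only; omega, by dsimp only; omega⟩
    · obtain ⟨k1, k2, k3⟩ := hl.glue hr h1 h2
      exact ⟨k1, by dsimp only; omega, by dsimp only; omega⟩
    · obtain ⟨g1, g2, g3⟩ := ihr hr (s - (size l + p.str.length))
      obtain ⟨k1, k2, k3, k4⟩ := hl.balance (p := p) g1 (by omega) (by omega)
      exact ⟨k1, by dsimp only; omega, by dsimp only; omega⟩

theorem items_removePart {t : BinaryTree Item} {s : ℕ} (hs : s < size t) :
    ∃ A B, items t = A ++ (removePart s t).1 :: B ∧ items (removePart s t).2.2 = A ++ B ∧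
      totalLength A + (removePart s t).2.1 = s ∧
      (removePart s t).2.1 < (removePart s t).1.str.length := by
  induction t generalizing s with
  | nil => simp [size] at hs
  | node p l r ihl ihr =>
    simp only [removePart, items]
    split_ifs with h1 h2
    · obtain ⟨A, B, g1, g2, g3, g4⟩ := ihl h1
      refine ⟨A, B ++ p :: items r, ?_, ?_, g3, g4⟩
      · simp [g1]
      · rw [items_balance, g2]
        simp
    · refine ⟨items l, items r, rfl, items_glue l r, ?_, ?_⟩
      · rw [totalLength_items]
        dsimp only
        omega
      · dsimp only
        omega
    · rw [size] at hs
      obtain ⟨A, B, g1, g2, g3, g4⟩ := @ihr (s - (size l + p.str.length)) (by omega)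
      refine ⟨items l ++ p :: A, B, ?_, ?_, ?_, g4⟩
      · simp [← g1]
      · rw [items_balance, g2]
        simp
      · rw [totalLength_append, totalLength_cons, totalLength_items]
        dsimp only
        omega

/-! ### Running times of the tree operations -/

theorem computes_height (t : BinaryTree Item) :
    Computes T 24 (encode t) 10 fun v => v = .num t.height := by
  refine calls_of_wp (body := heightBody) rfl ?_
  cases t <;> simp [heightBody, wp, lookup, encode, BinaryTree.height]

theorem computes_size (t : BinaryTree Item) :
    Computes T 25 (encode t) 10 fun v => v = .num (size t) := by
  refine calls_of_wp (body := sizeBody) rfl ?_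
  cases t <;> simp [sizeBody, wp, lookup, encode, size]

theorem computes_node (l : BinaryTree Item) (p : Item) (r : BinaryTree Item) :
    Computes T 11 (.pair (encode l) (.pair p.val (encode r))) 150 fun v =>
      v = encode (.node p l r) := by
  refine calls_of_wp (body := nodeBody) rfl ?_
  simp only [nodeBody, heightExpr, sizeExpr, wp, lookup]
  refine (computes_height l).bind ?_
  rintro _ t₁ ht₁ rfl
  refine (computes_height r).bind ?_
  rintro _ t₂ ht₂ rfl
  refine ⟨fun h => ?_, fun h => ?_⟩ <;>
  · refine (computes_size l).bind ?_
    rintro _ t₃ ht₃ rfl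
    simp only [Item.val, record]
    refine (computes_size r).bind ?_
    rintro _ t₄ ht₄ rfl
    refine ⟨by omega, ?_⟩
    rw [encode, Item.val, record]
    congr 3
    omega

theorem computes_balance (l : BinaryTree Item) (p : Item) (r : BinaryTree Item) :
    Computes T 12 (.pair (encode l) (.pair p.val (encode r))) 1000 fun v =>
      v = encode (balance l p r) := by
  refine calls_of_wp (body := balanceBody) rfl ?_
  simp only [balanceBody, heightExpr, nodeExpr, partExpr, leftExpr, rightExpr, wp, lookup]
  refine (computes_height r).bind ?_
  rintro _ t₁ ht₁ rfl
  refine (computes_height l).bind ?_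
  rintro _ t₂ ht₂ rfl
  unfold balance
  refine ⟨fun h1 => ?_, fun h1 => ?_⟩
  · rw [if_pos h1]
    rcases l with - | ⟨q, ll, lr⟩
    · simp [BinaryTree.height] at h1
    simp only [encode]
    refine (computes_height ll).bind ?_
    rintro _ t₃ ht₃ rfl
    refine (computes_height lr).bind ?_
    rintro _ t₄ ht₄ rfl
    refine ⟨fun h2 => ?_, fun h2 => ?_⟩
    · rw [if_pos h2]
      rcases lr with - | ⟨x, a, b⟩
      · simp [BinaryTree.height] at h2
      simp only [encode]
      refine (computes_node ll q a).bind ?_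
      rintro _ t₅ ht₅ rfl
      refine (computes_node b p r).bind ?_
      rintro _ t₆ ht₆ rfl
      refine (computes_node _ x _).bind ?_
      rintro _ t₇ ht₇ rfl
      exact ⟨by omega, rfl⟩
    · rw [if_neg h2]
      refine (computes_node lr p r).bind ?_
      rintro _ t₅ ht₅ rfl
      refine (computes_node _ q _).bind ?_
      rintro _ t₆ ht₆ rfl
      exact ⟨by omega, rfl⟩
  · rw [if_neg h1]
    refine (computes_height l).bind ?_
    rintro _ t₃ ht₃ rfl
    refine (computes_height r).bind ?_
    rintro _ t₄ ht₄ rfl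
    refine ⟨fun h2 => ?_, fun h2 => ?_⟩
    · rw [if_pos h2]
      rcases r with - | ⟨q, rl, rr⟩
      · simp [BinaryTree.height] at h2
      simp only [encode]
      refine (computes_height rr).bind ?_
      rintro _ t₅ ht₅ rfl
      refine (computes_height rl).bind ?_
      rintro _ t₆ ht₆ rfl
      refine ⟨fun h3 => ?_, fun h3 => ?_⟩
      · rw [if_pos h3]
        rcases rl with - | ⟨x, a, b⟩
        · simp [BinaryTree.height] at h3
        simp only [encode]
        refine (computes_node l p a).bind ?_
        rintro _ t₇ ht₇ rfl
        refine (computes_node b q rr).bind ?_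
        rintro _ t₈ ht₈ rfl
        refine (computes_node _ x _).bind ?_
        rintro _ t₉ ht₉ rfl
        exact ⟨by omega, rfl⟩
      · rw [if_neg h3]
        refine (computes_node l p rl).bind ?_
        rintro _ t₇ ht₇ rfl
        refine (computes_node _ q rr).bind ?_
        rintro _ t₈ ht₈ rfl
        exact ⟨by omega, rfl⟩
    · rw [if_neg h2]
      refine (computes_node l p r).bind ?_
      rintro _ t₅ ht₅ rfl
      exact ⟨by omega, rfl⟩

theorem computes_insertPart (x : Item) (s : ℕ) (t : BinaryTree Item) :
    Computes T 13 (.pair x.val (.pair (.num s) (encode t))) (1500 * (t.height + 1)) fun v =>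
      v = encode (insertPart x s t) := by
  induction t generalizing s with
  | nil =>
    refine calls_of_wp (body := insertPartBody) rfl ?_
    simp only [insertPartBody, sizeExpr, nodeExpr, partExpr, leftExpr, rightExpr, wp, lookup,
      encode]
    refine (computes_node .nil x .nil).bind ?_
    rintro _ t₁ ht₁ rfl
    exact ⟨by omega, rfl⟩
  | node p l r ihl ihr =>
    refine calls_of_wp (body := insertPartBody) rfl ?_
    simp only [insertPartBody, sizeExpr, nodeExpr, partExpr, leftExpr, rightExpr, wp, lookup,
      encode]
    refine (computes_size l).bind ?_
    rintro _ t₁ ht₁ rfl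
    rw [insertPart, BinaryTree.height]
    refine ⟨fun h => ?_, fun h => ?_⟩
    · rw [if_pos h]
      refine (computes_size l).bind ?_
      rintro _ t₂ ht₂ rfl
      simp only [Item.val, record]
      refine (ihr _).bind ?_
      rintro _ t₃ ht₃ rfl
      refine (computes_balance l p _).bind ?_
      rintro _ t₄ ht₄ rfl
      exact ⟨by omega, rfl⟩
    · rw [if_neg h]
      refine (ihl _).bind ?_
      rintro _ t₃ ht₃ rfl
      refine (computes_balance _ p r).bind ?_
      rintro _ t₄ ht₄ rfl
      exact ⟨by omega, rfl⟩

theorem computes_popFirst (p : Item) (l r : BinaryTree Item) :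
    Computes T 14 (encode (.node p l r)) (1500 * (l.height + 1)) fun v =>
      v = .pair (popFirst p l r).1.val (encode (popFirst p l r).2) := by
  induction l generalizing p r with
  | nil =>
    refine calls_of_wp (body := popFirstBody) rfl ?_
    simp only [popFirstBody, partExpr, leftExpr, rightExpr, wp, lookup, encode]
    exact ⟨by omega, rfl⟩
  | node q a b iha ihb =>
    refine calls_of_wp (body := popFirstBody) rfl ?_
    simp only [popFirstBody, partExpr, leftExpr, rightExpr, wp, lookup, encode]
    refine (iha q b).bind ?_
    rintro _ t₁ ht₁ rfl
    refine (computes_balance _ p r).bind ?_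
    rintro _ t₂ ht₂ rfl
    rw [BinaryTree.height]
    exact ⟨by omega, rfl⟩

theorem computes_glue (l r : BinaryTree Item) :
    Computes T 15 (.pair (encode l) (encode r)) (1500 * (r.height + 1)) fun v =>
      v = encode (glue l r) := by
  refine calls_of_wp (body := glueBody) rfl ?_
  rcases r with - | ⟨q, a, b⟩
  · simp only [glueBody, wp, lookup, encode]
    exact ⟨by omega, rfl⟩
  · simp only [glueBody, wp, lookup, encode]
    refine (computes_popFirst q a b).bind ?_
    rintro _ t₁ ht₁ rfl
    refine (computes_balance l _ _).bind ?_
    rintro _ t₂ ht₂ rfl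
    rw [BinaryTree.height]
    exact ⟨by omega, rfl⟩

/-- The subtrees are glued only once, at the node where the descent ends, so the two costs add along
a single path. -/
theorem computes_removePart {s : ℕ} {t : BinaryTree Item} (hs : s < size t) :
    Computes T 16 (.pair (.num s) (encode t)) (2000 * (t.height + 1)) fun v =>
      v = .pair (removePart s t).1.val
        (.pair (.num (removePart s t).2.1) (encode (removePart s t).2.2)) := by
  induction t generalizing s with
  | nil => simp [size] at hs
  | node p l r ihl ihr =>
    rw [size] at hs
    refine calls_of_wp (body := removePartBody) rfl ?_
    simp only [removePartBody, sizeExpr, partExpr, leftExpr, rightExpr, wp, lookup, encode]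
    refine (computes_size l).bind ?_
    rintro _ t₁ ht₁ rfl
    rw [removePart, BinaryTree.height]
    refine ⟨fun h => ?_, fun h => ?_⟩
    · rw [if_pos h]
      refine (ihl h).bind ?_
      rintro _ t₂ ht₂ rfl
      refine (computes_balance _ p r).bind ?_
      rintro _ t₃ ht₃ rfl
      exact ⟨by omega, rfl⟩
    · rw [if_neg h]
      simp only [Item.val, record]
      refine ⟨fun h2 => ?_, fun h2 => ?_⟩
      · rw [if_pos h2]
        refine (computes_glue l r).bind ?_
        rintro _ t₂ ht₂ rfl
        exact ⟨by omega, rfl⟩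
      · rw [if_neg h2]
        refine (ihr (by omega)).bind ?_
        rintro _ t₂ ht₂ rfl
        refine (computes_balance l p _).bind ?_
        rintro _ t₃ ht₃ rfl
        exact ⟨by omega, rfl⟩

/-! ### Occurrence partitions stored in trees -/

/-- An item that consists of a possible part and its suffix range. -/
def Item.Good (T : List ℕ) (x : Item) : Prop :=
  IsPart T x.str ∧ IsSuffixRange x.str T x.lo x.hi

/-- The string of a list of items. -/
def strs (L : List Item) : List ℕ := (L.map Item.str).flatten

@[simp] theorem strs_nil : strs [] = [] := rfl

@[simp] theorem strs_cons (x : Item) (L : List Item) : strs (x :: L) = x.str ++ strs L := rfl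

@[simp] theorem strs_append (L L' : List Item) : strs (L ++ L') = strs L ++ strs L' := by
  simp [strs]

theorem length_strs (L : List Item) : (strs L).length = totalLength L := by
  induction L with
  | nil => rfl
  | cons x L ih => simp [ih]

/-- No two consecutive items can be merged. -/
def Unmergeable (T : List ℕ) (L : List Item) : Prop :=
  (L.map Item.str).IsChain fun p q => ¬ (p ++ q) <:+: T

theorem unmergeable_append_cons {L L' : List Item} {x : Item} :
    Unmergeable T (L ++ x :: L') ↔ Unmergeable T (L ++ [x]) ∧ Unmergeable T (x :: L') := by
  simp only [Unmergeable, List.map_append, List.map_cons, List.map_nil]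
  exact List.isChain_split

theorem Unmergeable.left {L L' : List Item} (h : Unmergeable T (L ++ L')) : Unmergeable T L := by
  rw [Unmergeable, List.map_append] at h
  exact h.left_of_append

theorem Unmergeable.right {L L' : List Item} (h : Unmergeable T (L ++ L')) :
    Unmergeable T L' := by
  rw [Unmergeable, List.map_append] at h
  exact h.right_of_append

/-- An occurrence of `y.str` followed by the next part contains one of `x.str` followed by it. This
is why the right neighbour of an edit needs no test against its successor. -/
theorem Unmergeable.extend_head {L : List Item} {x y : Item} (h : Unmergeable T (x :: L))
    (hxy : x.str <:+ y.str) : Unmergeable T (y :: L) := by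
  rcases L with - | ⟨z, L⟩
  · simp [Unmergeable]
  · simp only [Unmergeable, List.map_cons, List.isChain_cons_cons] at h ⊢
    refine ⟨fun hi => h.1 (List.IsInfix.trans ?_ hi), h.2⟩
    obtain ⟨s, hs⟩ := hxy
    exact ⟨s, [], by simp [← hs]⟩

/-- The counterpart on the left: the pending part may grow to the right without becoming mergeable
with its predecessor. -/
theorem Unmergeable.extend_last {L : List Item} {x y : Item} (h : Unmergeable T (L ++ [x]))
    (hxy : x.str <+: y.str) : Unmergeable T (L ++ [y]) := by
  rcases L.eq_nil_or_concat with rfl | ⟨L, z, rfl⟩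
  · simp [Unmergeable]
  · rw [List.concat_eq_append, List.append_assoc, List.singleton_append,
      unmergeable_append_cons] at h ⊢
    refine ⟨h.1, ?_⟩
    simp only [Unmergeable, List.map_cons, List.map_nil, List.isChain_cons_cons,
      List.isChain_singleton, and_true] at h ⊢
    refine fun hi => h.2 (List.IsInfix.trans ?_ hi)
    obtain ⟨s, hs⟩ := hxy
    exact ⟨[], s, by simp [← hs]⟩

/-- A tree of items that stores an occurrence partition. -/
structure Stored (T P : List ℕ) (t : BinaryTree Item) : Prop where
  balanced : Balanced t
  good : ∀ x ∈ items t, x.Good T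
  unmergeable : Unmergeable T (items t)
  strs_eq : strs (items t) = P

theorem inorder_map_str (t : BinaryTree Item) :
    inorder (t.map Item.str) = (items t).map Item.str := by
  induction t with
  | nil => rfl
  | node x l r ihl ihr => simp [BinaryTree.map, inorder, items, ihl, ihr]

theorem height_map_str (t : BinaryTree Item) : (t.map Item.str).height = t.height := by
  induction t with
  | nil => rfl
  | node x l r ihl ihr => simp [BinaryTree.map, BinaryTree.height, ihl, ihr]

theorem isBalanced_map_str (t : BinaryTree Item) : IsBalanced (t.map Item.str) ↔ Balanced t := by
  induction t with
  | nil => rfl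
  | node x l r ihl ihr => simp [BinaryTree.map, IsBalanced, Balanced, ihl, ihr, height_map_str]

theorem length_flatten_inorder_map_str (t : BinaryTree Item) :
    (inorder (t.map Item.str)).flatten.length = size t := by
  rw [inorder_map_str, ← totalLength_items, ← length_strs]
  rfl

/-- The specification hides the end points of the ranges behind an existential at each node.
Collected in a tree of items, they make the pointer structure a function `encode` of the tree. -/
theorem encodesTree_iff {u : BinaryTree (List ℕ)} {v : Val} :
    EncodesTree T u v ↔ ∃ t : BinaryTree Item, t.map Item.str = u ∧ v = encode t ∧
      ∀ x ∈ items t, IsSuffixRange x.str T x.lo x.hi := by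
  induction u generalizing v with
  | nil =>
    constructor
    · rintro rfl
      exact ⟨.nil, rfl, rfl, by simp [items]⟩
    · rintro ⟨t, h, rfl, -⟩
      cases t with
      | nil => rfl
      | node x l r => simp [BinaryTree.map] at h
  | node p a b iha ihb =>
    constructor
    · rintro ⟨vp, vl, vr, ⟨lo, hi, h1, rfl⟩, h2, h3, rfl⟩
      obtain ⟨l, rfl, rfl, hl⟩ := iha.1 h2
      obtain ⟨r, rfl, rfl, hr⟩ := ihb.1 h3
      refine ⟨.node ⟨p, lo, hi⟩ l r, rfl, ?_, ?_⟩
      · have := length_flatten_inorder_map_str (.node ⟨p, lo, hi⟩ l r)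
        rw [BinaryTree.map] at this
        rw [this, BinaryTree.height, height_map_str, height_map_str]
        rfl
      · intro x hx
        simp only [items, List.mem_append, List.mem_cons] at hx
        rcases hx with hx | rfl | hx
        · exact hl x hx
        · exact h1
        · exact hr x hx
    · rintro ⟨t, h, rfl, h2⟩
      cases t with
      | nil => simp [BinaryTree.map] at h
      | node x l r =>
        simp only [BinaryTree.map, BinaryTree.node.injEq] at h
        obtain ⟨rfl, rfl, rfl⟩ := h
        refine ⟨x.val, encode l, encode r, ⟨x.lo, x.hi, h2 x (by simp [items]), rfl⟩,
          iha.2 ⟨l, rfl, rfl, fun y hy => h2 y (by simp [items, hy])⟩,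
          ihb.2 ⟨r, rfl, rfl, fun y hy => h2 y (by simp [items, hy])⟩, ?_⟩
        have := length_flatten_inorder_map_str (.node x l r)
        rw [BinaryTree.map] at this
        rw [this, BinaryTree.height, height_map_str, height_map_str]
        rfl

theorem storesPartition_iff {P : List ℕ} {v : Val} :
    StoresPartition P T v ↔ ∃ t, v = encode t ∧ Stored T P t := by
  constructor
  · rintro ⟨u, h1, h2, h3⟩
    obtain ⟨t, rfl, rfl, h4⟩ := encodesTree_iff.1 h3
    rw [inorder_map_str] at h2
    refine ⟨t, rfl, (isBalanced_map_str t).1 h1, fun x hx => ?_, h2.maximality, h2.flatten_eq⟩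
    have hm := List.mem_map_of_mem (f := Item.str) hx
    exact ⟨⟨h2.ne_nil _ hm, h2.occurrence _ hm⟩, h4 x hx⟩
  · rintro ⟨t, rfl, h⟩
    refine ⟨t.map Item.str, (isBalanced_map_str t).2 h.balanced, ?_,
      encodesTree_iff.2 ⟨t, rfl, rfl, fun x hx => (h.good x hx).2⟩⟩
    rw [inorder_map_str]
    refine ⟨h.strs_eq, ?_, ?_, h.unmergeable⟩
    · intro p hp
      obtain ⟨x, hx, rfl⟩ := List.mem_map.1 hp
      exact (h.good x hx).1.1
    · intro p hp
      obtain ⟨x, hx, rfl⟩ := List.mem_map.1 hp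
      exact (h.good x hx).1.2

/-- The slack `+ 1` covers the character added by an insertion. With `L = ⌊log₂ |T|⌋`, the bound `2
^ (h / 2) ≤ |T| + 2 < 2 ^ (L + 2)` gives `h + 1 ≤ 2 * L + 4`. -/
theorem height_le {t : BinaryTree Item} (hb : Balanced t) (hg : ∀ x ∈ items t, x.Good T)
    (hs : totalLength (items t) ≤ T.length + 1) : t.height + 1 ≤ 4 * (Nat.log 2 T.length + 1) := by
  have h1 := hb.pow_height_le fun x hx => (hg x hx).1.1
  have h2 := Nat.lt_pow_succ_log_self one_lt_two T.length
  have hlt : 2 ^ (t.height / 2) < 2 ^ ((Nat.log 2 T.length).succ + 1) := by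
    rw [totalLength_items] at hs
    rw [pow_succ]
    have : 1 < 2 ^ (Nat.log 2 T.length).succ := Nat.one_lt_two_pow (by omega)
    omega
  have := (Nat.pow_lt_pow_iff_right one_lt_two).1 hlt
  omega

theorem eq_nil_of_totalLength_eq_zero {L : List Item} (hg : ∀ x ∈ L, x.Good T)
    (h : totalLength L = 0) : L = [] := by
  rcases L with - | ⟨x, L⟩
  · rfl
  · have := List.length_pos_iff.2 (hg x (by simp)).1.1
    rw [totalLength_cons] at h
    omega

/-- Nonempty parts force the two splittings to agree. This identifies the part found at a boundary
position as the first one of `B`; `split_after` does the same for the last one of `A`. -/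
theorem split_before {A B A' B' : List Item} {x : Item} (hg : ∀ x ∈ A ++ B, x.Good T)
    (h : A ++ B = A' ++ x :: B') (h1 : totalLength A' ≤ totalLength A)
    (h2 : totalLength A < totalLength A' + x.str.length) : A = A' ∧ B = x :: B' := by
  rw [List.append_eq_append_iff] at h
  rcases h with ⟨C, rfl, rfl⟩ | ⟨C, rfl, h3⟩
  · rw [totalLength_append] at h1
    obtain rfl : C = [] := eq_nil_of_totalLength_eq_zero (T := T)
      (fun y hy => hg y (by simp [hy])) (by omega)
    simp
  · rcases C with - | ⟨y, C⟩
    · simpa using h3.symm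
    · obtain ⟨rfl, -⟩ := List.cons.inj h3
      simp at h2

theorem split_after {A B A' B' : List Item} {x : Item} (hg : ∀ x ∈ A ++ B, x.Good T)
    (h : A ++ B = A' ++ x :: B') (h1 : totalLength A' < totalLength A)
    (h2 : totalLength A ≤ totalLength A' + x.str.length) : A = A' ++ [x] ∧ B = B' := by
  rw [List.append_eq_append_iff] at h
  rcases h with ⟨C, rfl, rfl⟩ | ⟨C, rfl, h3⟩
  · rw [totalLength_append] at h1
    omega
  · rcases C with - | ⟨y, C⟩
    · simp at h1
    · obtain ⟨rfl, rfl⟩ := List.cons.inj h3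
      rw [totalLength_append, totalLength_cons] at h2
      obtain rfl : C = [] := eq_nil_of_totalLength_eq_zero (T := T)
        (fun y hy => hg y (by simp [hy])) (by omega)
      simp

/-! ### Partial results -/

/-- A good item, or the empty item. -/
def Item.Pending (T : List ℕ) (x : Item) : Prop := x = Item.empty ∨ x.Good T

theorem Item.Good.length_pos {x : Item} (h : x.Good T) : 0 < x.str.length :=
  List.length_pos_iff.2 h.1.1

/-- The value `v` is a partial result: the pending item `cur`, and a tree of the items `A` before
and the items `B` after it. -/
structure Partial (T : List ℕ) (A : List Item) (cur : Item) (B : List Item) (v : Val) : Prop where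
  tree : ∃ t, v = .pair cur.val (.pair (.num (totalLength A)) (encode t)) ∧ Balanced t ∧
    items t = A ++ B
  good : ∀ x ∈ A ++ B, x.Good T
  -- The pending item is empty only at the left end of the pattern. Nothing is claimed yet about
  -- `cur` and `B`.
  cur : (cur = Item.empty ∧ A = []) ∨ (cur.Good T ∧ Unmergeable T (A ++ [cur]))

/-- One greedy step. Either branch keeps `A ++ [cur]` unmergeable: a merge enlarges the last part,
and a failed merge is itself the missing condition. An empty piece changes nothing. The suffix
relation in the conclusion serves the final step, where `q` is the part after the gap. -/
theorem computes_extend {A B : List Item} {cur q : Item} {v : Val} (h : Partial T A cur B v)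
    (hq : q.Pending T) (hs : totalLength A + totalLength B ≤ T.length + 1) :
    Computes T 17 (.pair q.val v) (7000 * (Nat.log 2 T.length + 1)) fun v' =>
      ∃ A' cur', Partial T A' cur' B v' ∧
        strs A' ++ cur'.str = strs A ++ cur.str ++ q.str ∧ q.str <:+ cur'.str := by
  obtain ⟨⟨t, rfl, hb, ht⟩, hg, hc⟩ := h
  have hh := height_le (T := T) hb (by rwa [ht]) (by rwa [ht, totalLength_append])
  refine calls_of_wp (body := extendBody) rfl ?_
  simp only [extendBody, wp, lookup, Item.val, record]
  refine ⟨fun h1 => ⟨fun h2 => ?_, fun h2 => ?_⟩, fun h1 => ?_⟩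
  · have hqg : q.Good T := by
      rcases hq with rfl | hq
      · simp [Item.empty] at h1
      · exact hq
    have hcg : cur.Good T ∧ Unmergeable T (A ++ [cur]) := by
      rcases hc with ⟨rfl, -⟩ | hc
      · simp [Item.empty] at h2
      · exact hc
    refine (computes_concat hcg.1.1.1 hqg.1.1 hcg.1.2 hqg.2).bind ?_
    rintro _ t₁ ht₁ ⟨l, r, rfl, hlr⟩
    have hne : cur.str ++ q.str ≠ [] := by simp [hqg.1.1]
    simp only [record]
    refine ⟨fun h3 => ?_, fun h3 => ?_⟩
    · refine ⟨by omega, A, ⟨cur.str ++ q.str, l, r⟩, ⟨⟨t, rfl, hb, ht⟩, hg, .inr ⟨⟨⟨hne,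
        .inl ((hlr.lt_iff hne).1 h3)⟩, hlr⟩, hcg.2.extend_last (List.prefix_append _ _)⟩⟩, ?_,
        List.suffix_append _ _⟩
      simp
    · refine (computes_insertPart cur (totalLength A) t).bind ?_
      rintro _ t₂ ht₂ rfl
      refine ⟨by omega, A ++ [cur], q, ⟨⟨insertPart cur (totalLength A) t, ?_,
        (hb.insertPart _ _).1, ?_⟩, ?_, .inr ⟨hqg, ?_⟩⟩, ?_, List.suffix_rfl⟩
      · simp [Item.val, record]
      · rw [items_insertPart (fun y hy => (hg y (ht ▸ hy)).1.1) ht]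
        simp
      · intro x hx
        simp only [List.mem_append, List.mem_singleton] at hx
        rcases hx with (hx | rfl) | hx
        · exact hg x (by simp [hx])
        · exact hcg.1
        · exact hg x (by simp [hx])
      · rw [List.append_assoc, List.singleton_append, unmergeable_append_cons]
        refine ⟨hcg.2, ?_⟩
        simp only [Unmergeable, List.map_cons, List.map_nil, List.isChain_cons_cons,
          List.isChain_singleton, and_true]
        exact fun hi => h3 ((hlr.lt_iff hne).2 hi)
      · simp
  · have hqg : q.Good T := by
      rcases hq with rfl | hq
      · simp [Item.empty] at h1
      · exact hq
    obtain ⟨rfl, rfl⟩ : cur = Item.empty ∧ A = [] := by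
      rcases hc with hc | hc
      · exact hc
      · exact absurd hc.1.length_pos h2
    refine ⟨by omega, [], q, ⟨⟨t, rfl, hb, ht⟩, hg, .inr ⟨hqg, by simp [Unmergeable]⟩⟩, ?_,
      List.suffix_rfl⟩
    simp [Item.empty]
  · have hqe : q.str = [] := by
      rw [← List.length_eq_zero_iff]
      omega
    refine ⟨by omega, A, cur, ⟨⟨t, rfl, hb, ht⟩, hg, hc⟩, ?_, ?_⟩ <;> simp [hqe]

theorem computes_start {A B : List Item} {t : BinaryTree Item} (hb : Balanced t)
    (ht : items t = A ++ B) (hg : ∀ x ∈ A ++ B, x.Good T) (hA : Unmergeable T A)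
    (hs : totalLength A + totalLength B ≤ T.length + 1) :
    Computes T 18 (.pair (.num (totalLength A)) (encode t))
      (9000 * (Nat.log 2 T.length + 1)) fun v =>
      ∃ A' cur, Partial T A' cur B v ∧ strs A' ++ cur.str = strs A ∧
        totalLength A' ≤ totalLength A := by
  have hh := height_le (T := T) hb (by rwa [ht]) (by rwa [ht, totalLength_append])
  have hsize := totalLength_items t
  rw [ht, totalLength_append] at hsize
  refine calls_of_wp (body := startBody) rfl ?_
  simp only [startBody, wp, lookup]
  refine ⟨fun h => ?_, fun h => ?_⟩
  -- Position `totalLength A - 1` is the last character of the last part of `A`.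
  · have hlt : totalLength A - 1 < size t := by omega
    refine (computes_removePart hlt).bind ?_
    rintro _ t₁ ht₁ rfl
    obtain ⟨A', B', h1, h2, h3, h4⟩ := items_removePart hlt
    rw [ht] at h1
    obtain ⟨hA', rfl⟩ := split_after hg h1 (by omega) (by omega)
    have hb' := (hb.removePart (totalLength A - 1)).1
    generalize removePart (totalLength A - 1) t = R at *
    obtain ⟨x, o, t'⟩ := R
    simp only [Item.val, record] at *
    subst hA'
    have hx : x.Good T := hg x (by simp)
    refine ⟨by omega, A', x, ⟨⟨t', ?_, hb', h2⟩, fun y hy => hg y ?_, .inr ⟨hx, hA⟩⟩, ?_, ?_⟩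
    · simp [Item.val, record]
    · simp only [List.mem_append] at hy ⊢
      exact hy.imp_left .inl
    · simp
    · simp
  · obtain rfl : A = [] := eq_nil_of_totalLength_eq_zero (T := T)
      (fun x hx => hg x (by simp [hx])) (by omega)
    exact ⟨by omega, [], Item.empty, ⟨⟨t, rfl, hb, ht⟩, hg, .inl ⟨rfl, rfl⟩⟩, rfl, le_rfl⟩

theorem computes_close {A B : List Item} {cur : Item} {v : Val} (h : Partial T A cur B v)
    (hs : totalLength A + totalLength B ≤ T.length + 1) :
    Computes T 19 v (7000 * (Nat.log 2 T.length + 1)) fun v' =>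
      ∃ t, v' = encode t ∧ Balanced t ∧
        ((cur = Item.empty ∧ A = [] ∧ items t = B) ∨
          (cur.Good T ∧ Unmergeable T (A ++ [cur]) ∧ items t = A ++ cur :: B)) := by
  obtain ⟨⟨t, rfl, hb, ht⟩, hg, hc⟩ := h
  have hh := height_le (T := T) hb (by rwa [ht]) (by rwa [ht, totalLength_append])
  refine calls_of_wp (body := closeBody) rfl ?_
  simp only [closeBody, wp, lookup]
  rcases hc with ⟨rfl, rfl⟩ | ⟨hc, hu⟩
  · simp only [Item.val, record, Item.empty]
    exact ⟨fun h => absurd h (lt_irrefl _),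
      fun _ => ⟨by omega, t, rfl, hb, .inl ⟨trivial, trivial, ht⟩⟩⟩
  · refine ⟨fun _ => ?_, fun h => absurd hc.length_pos h⟩
    refine (computes_insertPart cur (totalLength A) t).bind ?_
    rintro _ t₂ ht₂ rfl
    exact ⟨by omega, _, rfl, (hb.insertPart _ _).1, .inr ⟨hc, hu,
      items_insertPart (fun y hy => (hg y (ht ▸ hy)).1.1) ht⟩⟩

/-- One more extension, by the first part of `B`, is enough. The new pending part ends with it, and
it was already unmergeable with its successor. -/
theorem computes_finish {A B : List Item} {cur : Item} {v : Val} (h : Partial T A cur B v)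
    (hB : Unmergeable T B)
    (hs : totalLength A + cur.str.length + totalLength B ≤ T.length + 1) :
    Computes T 20 v (25000 * (Nat.log 2 T.length + 1)) fun v' =>
      ∃ t, v' = encode t ∧ Stored T (strs A ++ cur.str ++ strs B) t := by
  have h' := h
  obtain ⟨⟨t, rfl, hb, ht⟩, hg, hc⟩ := h
  have hh := height_le (T := T) hb (by rwa [ht]) (by rw [ht, totalLength_append]; omega)
  have hsize := totalLength_items t
  rw [ht, totalLength_append] at hsize
  refine calls_of_wp (body := finishBody) rfl ?_
  simp only [finishBody, sizeExpr, wp, lookup]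
  refine (computes_size t).bind ?_
  rintro _ t₁ ht₁ rfl
  refine ⟨fun hlt => ?_, fun hge => ?_⟩
  · refine (computes_removePart hlt).bind ?_
    rintro _ t₂ ht₂ rfl
    obtain ⟨A', B', h1, h2, h3, h4⟩ := items_removePart hlt
    rw [ht] at h1
    obtain ⟨rfl, rfl⟩ := split_before hg h1 (by omega) (by omega)
    have hb' := (hb.removePart (totalLength A)).1
    generalize removePart (totalLength A) t = R at *
    obtain ⟨x, o, t'⟩ := R
    dsimp only at *
    have hx : x.Good T := hg x (by simp)
    rw [totalLength_cons] at hs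
    have hp : Partial T A cur B' (.pair cur.val (.pair (.num (totalLength A)) (encode t'))) :=
      ⟨⟨t', rfl, hb', h2⟩, fun y hy => hg y (by
        simp only [List.mem_append, List.mem_cons] at hy ⊢
        exact hy.imp_right .inr), hc⟩
    refine (computes_extend hp (.inr hx) (by omega)).bind ?_
    rintro v t₃ ht₃ ⟨A'', cur', hp', h5, h6⟩
    have hlen := congrArg List.length h5
    simp only [List.length_append, length_strs] at hlen
    refine (computes_close hp' (by omega)).bind ?_
    rintro _ t₄ ht₄ ⟨u, rfl, hu, h7⟩
    rcases h7 with ⟨rfl, -, -⟩ | ⟨hcg, hun, hit⟩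
    · exact absurd (List.suffix_nil.1 h6) hx.1.1
    · refine ⟨by omega, u, rfl, hu, fun y hy => ?_, ?_, ?_⟩
      · rw [hit] at hy
        simp only [List.mem_append, List.mem_cons] at hy
        rcases hy with hy | rfl | hy
        · exact hp'.good y (by simp [hy])
        · exact hcg
        · exact hp'.good y (by simp [hy])
      · rw [hit, unmergeable_append_cons]
        exact ⟨hun, hB.extend_head h6⟩
      · rw [hit, strs_append, strs_cons, strs_cons, ← List.append_assoc, h5]
        simp
  · obtain rfl : B = [] := eq_nil_of_totalLength_eq_zero (T := T)
      (fun x hx => hg x (by simp [hx])) (by omega)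
    refine (computes_close h' (by omega)).bind ?_
    rintro _ t₄ ht₄ ⟨u, rfl, hu, h7⟩
    refine ⟨by omega, u, rfl, ?_⟩
    rcases h7 with ⟨rfl, rfl, hit⟩ | ⟨hcg, hun, hit⟩
    · exact ⟨hu, by simp [hit], by simp [hit, Unmergeable], by simp [hit, Item.empty]⟩
    · refine ⟨hu, fun y hy => ?_, by rwa [hit], by simp [hit]⟩
      rw [hit, List.mem_append, List.mem_singleton] at hy
      rcases hy with hy | rfl
      · exact hg y (by simp [hy])
      · exact hcg

/-! ### The three operations -/

theorem computes_subItem {x : Item} {o m : ℕ} (hx : x.Good T) (hom : o + m ≤ x.str.length) :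
    Computes T 10 (.pair x.val (.pair (.num o) (.num m))) (1100 * (Nat.log 2 T.length + 1))
      fun v => ∃ y : Item, v = y.val ∧ y.Pending T ∧ y.str = (x.str.drop o).take m := by
  refine (computes_subRecord hx.1 hx.2 hom).bind ?_
  rintro _ t ht ⟨l, r, rfl, h1, h2⟩
  refine ⟨ht, ⟨(x.str.drop o).take m, l, r⟩, rfl, ?_, rfl⟩
  by_cases hq : (x.str.drop o).take m = []
  · obtain ⟨rfl, rfl⟩ := h2 hq
    exact .inl (by rw [hq]; rfl)
  · exact .inr ⟨hx.1.of_infix hq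
      ((List.take_prefix _ _).isInfix.trans (List.drop_suffix _ _).isInfix), h1 hq⟩

theorem computes_charItem (c : ℕ) :
    Computes T 3 (.num c) (600 * (Nat.log 2 T.length + 1)) fun v =>
      ∃ y : Item, v = y.val ∧ y.Pending T ∧ y.str = [c] := by
  refine (computes_charRecord c).bind ?_
  rintro _ t ht ⟨l, r, rfl, h⟩
  exact ⟨ht, ⟨[c], l, r⟩, rfl, .inr ⟨isPart_singleton c, h⟩, rfl⟩

theorem insertIdx_length_append (A B : List ℕ) (c : ℕ) :
    (A ++ B).insertIdx A.length c = A ++ c :: B := by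
  induction A with
  | nil => simp
  | cons a A ih => simp [ih]

theorem insertIdx_append_append {A p B : List ℕ} {o c : ℕ} (ho : o ≤ p.length) :
    (A ++ (p ++ B)).insertIdx (A.length + o) c = A ++ p.take o ++ [c] ++ p.drop o ++ B := by
  have h := insertIdx_length_append (A ++ p.take o) (p.drop o ++ B) c
  rw [List.length_append, List.length_take_of_le ho, List.append_assoc A,
    ← List.append_assoc (p.take o) (p.drop o), List.take_append_drop] at h
  rw [h]
  simp

theorem eraseIdx_append_append {A p B : List ℕ} {o : ℕ} (ho : o < p.length) :
    (A ++ (p ++ B)).eraseIdx (A.length + o) = A ++ p.take o ++ p.drop (o + 1) ++ B := by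
  rw [List.eraseIdx_append_of_length_le (by omega), Nat.add_sub_cancel_left,
    List.eraseIdx_append_of_lt_length ho, List.eraseIdx_eq_take_drop_succ]
  simp

theorem computes_insert {P : List ℕ} {t : BinaryTree Item} {i c : ℕ} (h : Stored T P t)
    (hP : P.length ≤ T.length) (hi : i ≤ P.length) :
    Computes T 21 (.pair (.num i) (.pair (.num c) (encode t)))
      (100000 * (Nat.log 2 T.length + 1)) fun v =>
      ∃ t', v = encode t' ∧ Stored T (P.insertIdx i c) t' := by
  obtain ⟨hb, hg, hun, rfl⟩ := h
  rw [length_strs] at hi hP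
  have hh := height_le hb hg (by omega)
  have hsize := totalLength_items t
  refine calls_of_wp (body := insertBody) rfl ?_
  simp only [insertBody, sizeExpr, wp, lookup]
  refine (computes_size t).bind ?_
  rintro _ t₁ ht₁ rfl
  refine ⟨fun hlt => ?_, fun hge => ?_⟩
  · refine (computes_removePart hlt).bind ?_
    rintro _ t₂ ht₂ rfl
    obtain ⟨A, B, h1, h2, h3, h4⟩ := items_removePart hlt
    have hb' := (hb.removePart i).1
    generalize removePart i t = R at *
    obtain ⟨x, o, t'⟩ := R
    dsimp only at *
    rw [h1] at hg hun hP ⊢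
    rw [totalLength_append, totalLength_cons] at hP
    have hx : x.Good T := hg x (by simp)
    -- The removed part started at `i - o`, which is now the boundary between `A` and `B`.
    rw [show i - o = totalLength A by omega]
    refine (computes_start hb' h2 (fun y hy => hg y ?_) hun.left (by omega)).bind ?_
    · simp only [List.mem_append, List.mem_cons] at hy ⊢
      exact hy.imp_right .inr
    rintro v₁ t₃ ht₃ ⟨A₁, cur₁, hp₁, hs₁, -⟩
    refine (computes_subItem hx (by omega)).bind ?_
    rintro _ t₄ ht₄ ⟨y₁, rfl, hy₁, hstr₁⟩
    have hlen₁ := congrArg List.length hs₁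
    simp only [List.length_append, length_strs] at hlen₁
    refine (computes_extend hp₁ hy₁ (by omega)).bind ?_
    rintro v₂ t₅ ht₅ ⟨A₂, cur₂, hp₂, hs₂, -⟩
    refine (computes_charItem c).bind ?_
    rintro _ t₆ ht₆ ⟨y₂, rfl, hy₂, hstr₂⟩
    have hlen₂ := congrArg List.length hs₂
    simp only [List.length_append, length_strs, hstr₁, List.length_take, List.length_drop]
      at hlen₂
    refine (computes_extend hp₂ hy₂ (by omega)).bind ?_
    rintro v₃ t₇ ht₇ ⟨A₃, cur₃, hp₃, hs₃, -⟩
    simp only [Item.val, record]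
    refine (computes_subItem (o := o) (m := x.str.length - o) hx (by omega)).bind ?_
    rintro _ t₈ ht₈ ⟨y₃, rfl, hy₃, hstr₃⟩
    have hlen₃ := congrArg List.length hs₃
    simp only [List.length_append, length_strs, hstr₂, List.length_singleton] at hlen₃
    refine (computes_extend hp₃ hy₃ (by omega)).bind ?_
    rintro v₄ t₉ ht₉ ⟨A₄, cur₄, hp₄, hs₄, -⟩
    have hlen₄ := congrArg List.length hs₄
    simp only [List.length_append, length_strs, hstr₃, List.length_take, List.length_drop]
      at hlen₄
    refine (computes_finish hp₄ hun.right.tail (by omega)).bind ?_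
    rintro _ t₁₀ ht₁₀ ⟨u, rfl, hu⟩
    refine ⟨by omega, u, rfl, ?_⟩
    rw [strs_append, strs_cons, ← h3, ← length_strs, insertIdx_append_append h4.le]
    rw [hs₄, hs₃, hs₂, hs₁, hstr₁, hstr₂, hstr₃, List.drop_zero, List.take_of_length_le
      (l := x.str.drop o) (by simp)] at hu
    exact hu
  -- No part contains the position `|P|`, so nothing is cut and only the last part can absorb `c`.
  · obtain rfl : i = totalLength (items t) := by omega
    refine (computes_charItem c).bind ?_
    rintro _ t₂ ht₂ ⟨y, rfl, hy, hstr⟩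
    refine (computes_start (B := []) hb (by simp) (by simpa using hg) hun
      (by simp; omega)).bind ?_
    rintro v₁ t₃ ht₃ ⟨A₁, cur₁, hp₁, hs₁, -⟩
    have hlen₁ := congrArg List.length hs₁
    simp only [List.length_append, length_strs] at hlen₁
    refine (computes_extend hp₁ hy (by rw [totalLength_nil]; omega)).bind ?_
    rintro v₂ t₅ ht₅ ⟨A₂, cur₂, hp₂, hs₂, -⟩
    have hlen₂ := congrArg List.length hs₂
    simp only [List.length_append, length_strs, hstr, List.length_singleton] at hlen₂
    refine (computes_finish hp₂ (by simp [Unmergeable]) (by rw [totalLength_nil]; omega)).bind ?_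
    rintro _ t₁₀ ht₁₀ ⟨u, rfl, hu⟩
    refine ⟨by omega, u, rfl, ?_⟩
    rw [← length_strs, List.insertIdx_length_self]
    rw [hs₂, hs₁, hstr] at hu
    simpa using hu

theorem computes_delete {P : List ℕ} {t : BinaryTree Item} {i : ℕ} (h : Stored T P t)
    (hP : P.length ≤ T.length) (hi : i < P.length) :
    Computes T 22 (.pair (.num i) (encode t)) (100000 * (Nat.log 2 T.length + 1)) fun v =>
      ∃ t', v = encode t' ∧ Stored T (P.eraseIdx i) t' := by
  obtain ⟨hb, hg, hun, rfl⟩ := h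
  rw [length_strs] at hi hP
  have hh := height_le hb hg (by omega)
  rw [totalLength_items] at hi
  refine calls_of_wp (body := deleteBody) rfl ?_
  simp only [deleteBody, wp, lookup]
  refine (computes_removePart hi).bind ?_
  rintro _ t₂ ht₂ rfl
  obtain ⟨A, B, h1, h2, h3, h4⟩ := items_removePart hi
  have hb' := (hb.removePart i).1
  generalize removePart i t = R at *
  obtain ⟨x, o, t'⟩ := R
  dsimp only at *
  rw [h1] at hg hun hP ⊢
  rw [totalLength_append, totalLength_cons] at hP
  have hx : x.Good T := hg x (by simp)
  rw [show i - o = totalLength A by omega]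
  refine (computes_start hb' h2 (fun y hy => hg y ?_) hun.left (by omega)).bind ?_
  · simp only [List.mem_append, List.mem_cons] at hy ⊢
    exact hy.imp_right .inr
  rintro v₁ t₃ ht₃ ⟨A₁, cur₁, hp₁, hs₁, -⟩
  refine (computes_subItem hx (by omega)).bind ?_
  rintro _ t₄ ht₄ ⟨y₁, rfl, hy₁, hstr₁⟩
  have hlen₁ := congrArg List.length hs₁
  simp only [List.length_append, length_strs] at hlen₁
  refine (computes_extend hp₁ hy₁ (by omega)).bind ?_
  rintro v₂ t₅ ht₅ ⟨A₂, cur₂, hp₂, hs₂, -⟩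
  have hlen₂ := congrArg List.length hs₂
  simp only [List.length_append, length_strs, hstr₁, List.length_take, List.length_drop]
    at hlen₂
  simp only [Item.val, record]
  refine (computes_subItem (o := o + 1) (m := x.str.length - (o + 1)) hx (by omega)).bind ?_
  rintro _ t₈ ht₈ ⟨y₃, rfl, hy₃, hstr₃⟩
  refine (computes_extend hp₂ hy₃ (by omega)).bind ?_
  rintro v₄ t₉ ht₉ ⟨A₄, cur₄, hp₄, hs₄, -⟩
  have hlen₄ := congrArg List.length hs₄
  simp only [List.length_append, length_strs, hstr₃, List.length_take, List.length_drop]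
    at hlen₄
  refine (computes_finish hp₄ hun.right.tail (by omega)).bind ?_
  rintro _ t₁₀ ht₁₀ ⟨u, rfl, hu⟩
  refine ⟨by omega, u, rfl, ?_⟩
  rw [strs_append, strs_cons, ← h3, ← length_strs, eraseIdx_append_append h4]
  rw [hs₄, hs₂, hs₁, hstr₁, hstr₃, List.drop_zero, List.take_of_length_le
    (l := x.str.drop (o + 1)) (by simp)] at hu
  exact hu

/-! ### Counting occurrences -/

theorem card_occurrences_of_not_infix {P : List ℕ} (h : ¬ P <:+: T) :
    (occurrences P T).card = 0 := by
  rw [Finset.card_eq_zero, Finset.eq_empty_iff_forall_notMem]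
  intro i hi
  exact h (infix_of_prefix_drop (Finset.mem_filter.1 hi).2)

/-- An occurrence of the whole pattern would contain one of two adjacent parts. -/
theorem Unmergeable.not_infix {x y : Item} {L L' : List Item}
    (h : Unmergeable T (L ++ x :: y :: L')) : ¬ strs (L ++ x :: y :: L') <:+: T := by
  have h' := h.right
  simp only [Unmergeable, List.map_cons, List.isChain_cons_cons] at h'
  exact fun hi => h'.1 (List.IsInfix.trans ⟨strs L, strs L', by simp⟩ hi)

theorem computes_count {P : List ℕ} {t : BinaryTree Item} (h : Stored T P t) :
    Computes T 23 (encode t) 50 fun v => v = .num (occurrences P T).card := by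
  obtain ⟨hb, hg, hun, rfl⟩ := h
  refine calls_of_wp (body := countBody) rfl ?_
  rcases t with - | ⟨x, l, r⟩
  -- Without parts the pattern is empty and occurs at all `|T|` positions.
  · simp [countBody, wp, lookup, encode, textArrays, occurrences, items]
  rcases l with - | ⟨y, a, b⟩
  · rcases r with - | ⟨y, a, b⟩
    · have hx := hg x (by simp [items])
      simp [countBody, wp, lookup, encode, partExpr, leftExpr, rightExpr, items, Item.val, record,
        hx.2.card]
    · obtain ⟨z, L, hz⟩ :=
        List.exists_cons_of_ne_nil (show items (.node y a b) ≠ [] by simp [items])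
      rw [items, hz] at hun ⊢
      rw [card_occurrences_of_not_infix hun.not_infix]
      simp [countBody, wp, lookup, encode, partExpr, leftExpr, rightExpr]
  · obtain ⟨L, z, hz⟩ := (items (.node y a b)).eq_nil_or_concat.resolve_left (by simp [items])
    rw [items, hz, List.concat_eq_append, List.append_assoc, List.singleton_append] at hun ⊢
    rw [card_occurrences_of_not_infix hun.not_infix]
    simp [countBody, wp, lookup, encode, partExpr, leftExpr, rightExpr]

end DynPattern

theorem mainTheorem1 :
    ∃ (prog : DynPattern.Program) (insertFn deleteFn countFn C : ℕ),
      ∀ (T P : List ℕ) (v : DynPattern.Val),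
        P.length ≤ T.length → DynPattern.StoresPartition P T v →
        (∀ i ≤ P.length, ∀ c : ℕ, ∃ (v' : DynPattern.Val) (t : ℕ),
          DynPattern.Runs prog (DynPattern.textArrays T) insertFn
            (.pair (.num i) (.pair (.num c) v)) v' t ∧
          t ≤ C * (Nat.log 2 T.length + 1) ∧
          DynPattern.StoresPartition (P.insertIdx i c) T v') ∧
        (∀ i < P.length, ∃ (v' : DynPattern.Val) (t : ℕ),
          DynPattern.Runs prog (DynPattern.textArrays T) deleteFn (.pair (.num i) v) v' t ∧
          t ≤ C * (Nat.log 2 T.length + 1) ∧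
          DynPattern.StoresPartition (P.eraseIdx i) T v') ∧
        ∃ t ≤ C, DynPattern.Runs prog (DynPattern.textArrays T) countFn v
          (.num (DynPattern.occurrences P T).card) t := by
  -- A generous bound: the costs of a constant number of removals, extensions and searches add up to
  -- less.
  refine ⟨DynPattern.dynProg, 21, 22, 23, 100000, fun T P v hP hv => ?_⟩
  obtain ⟨t, rfl, ht⟩ := DynPattern.storesPartition_iff.1 hv
  refine ⟨fun i hi c => ?_, fun i hi => ?_, ?_⟩
  · obtain ⟨v', n, hr, hn, t', rfl, ht'⟩ := DynPattern.computes_insert (c := c) ht hP hi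
    exact ⟨_, n, hr, hn, DynPattern.storesPartition_iff.2 ⟨t', rfl, ht'⟩⟩
  · obtain ⟨v', n, hr, hn, t', rfl, ht'⟩ := DynPattern.computes_delete ht hP hi
    exact ⟨_, n, hr, hn, DynPattern.storesPartition_iff.2 ⟨t', rfl, ht'⟩⟩
  · obtain ⟨v', n, hr, hn, rfl⟩ := DynPattern.computes_count ht
    exact ⟨n, hn.trans (by norm_num), hr⟩
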